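/- Let $\mathcal S_n(321)$ be the set of permutations $\sigma$ of $\{1,\dots,n\}$ that avoid the pattern $321$ (there are no $i<j<k$ with $\sigma(i)>\sigma(j)>\sigma(k)$), and let $\mathcal D_n$ be the set of Dyck paths of length $2n$, i.e. lattice paths from $(0,0)$ to $(2n,0)$ with up-steps $u=(1,1)$ and down-steps $d=(1,-1)$ that never go below the $x$-axis. For $\sigma\in\mathcal S_n(321)$ let $(P,Q)$ be the pair of the insertion tableau and the recording tableau that the Robinson–Schensted–Knuth correspondence (row insertion of $\sigma(1),\dots,\sigma(n)$) assigns to $\sigma$; both tableaux have at most two rows. Let $A$ be the word whose $i$-th letter, for $i=1,\dots,n$, is $u$ if $i$ is on the first row of $P$ and $d$ if $i$ is on the second row of $P$; let $B$ be the word obtained from $Q$ in the same way. Let $\Psi(\sigma)$ be the path given by $A$ followed by $B$ traversed from right to left (the order of the letters of $B$ is reversed and $u$ and $d$ are interchanged). A tunnel of a path $D\in\mathcal D_n$ is a horizontal segment between two distinct lattice points of $D$ that meets $D$ only in these two points and stays below $D$. It is centered if the $x$-coordinate of its midpoint is equal to $n$, and it is a right tunnel if that coordinate is greater than $n$. Let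 $\mathrm{ct}(D)$ and $\mathrm{rt}(D)$ be the numbers of centered tunnels and of right tunnels of $D$, and let $\mathrm{h}(D)$ be the height of $D$ at $x=n$. Let $\mathrm{fp}(\sigma)=|\{i:\sigma(i)=i\}|$, $\mathrm{exc}(\sigma)=|\{i:\sigma(i)>i\}|$, and let $\ell(\sigma)$ be the length of the longest increasing subsequence of $\sigma$. Then $\Psi$ is a well-defined bijection $\mathcal S_n(321)\to\mathcal D_n$, and for all $\sigma\in\mathcal S_n(321)$ $$\mathrm{fp}(\sigma)=\mathrm{ct}(\Psi(\sigma)),\qquad \mathrm{exc}(\sigma)=\mathrm{rt}(\Psi(\sigma)),\qquad \ell(\sigma)=\tfrac12\bigl(n+\mathrm{h}(\Psi(\sigma))\bigr).$$ -/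

import Mathlib

namespace KnuthDyck

/-! ### Permutations: pattern avoidance and statistics

Positions and values `1, …, n` are represented by `Fin n`, that is, by `0, …, n - 1`. -/

/-- `σ` contains the pattern `π`: there are indices `i₁ < ⋯ < iₘ` such that
`(σ(i₁), …, σ(iₘ))` is in the same relative order as `(π(1), …, π(m))`. -/
def Contains {n m : ℕ} (σ : Equiv.Perm (Fin n)) (π : Equiv.Perm (Fin m)) : Prop :=
  ∃ f : Fin m → Fin n, StrictMono f ∧ ∀ a b : Fin m, σ (f a) < σ (f b) ↔ π a < π b

/-- The pattern `321`. -/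
def pattern321 : Equiv.Perm (Fin 3) := Fin.revPerm

/-- The set of `π`-avoiding permutations of `n` elements. -/
def avoiding (n : ℕ) {m : ℕ} (π : Equiv.Perm (Fin m)) : Set (Equiv.Perm (Fin n)) :=
  {σ | ¬ Contains σ π}

/-- The number of fixed points. -/
def fp {n : ℕ} (σ : Equiv.Perm (Fin n)) : ℕ :=
  (Finset.univ.filter fun i : Fin n => σ i = i).card

/-- The number of excedances. -/
def exc {n : ℕ} (σ : Equiv.Perm (Fin n)) : ℕ :=
  (Finset.univ.filter fun i : Fin n => i < σ i).card

/-- The length of the longest increasing subsequence: the largest `m` for which there are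
indices `i₁ < ⋯ < iₘ` with `σ(i₁) < ⋯ < σ(iₘ)`. (The set below contains `0` and is
bounded by `n`.) -/
noncomputable def lis {n : ℕ} (σ : Equiv.Perm (Fin n)) : ℕ :=
  sSup {m : ℕ | ∃ f : Fin m → Fin n, StrictMono f ∧ StrictMono fun k => σ (f k)}

/-! ### The Robinson–Schensted–Knuth correspondence

A tableau is the list of its rows, from top to bottom. -/

section RSK

variable {α : Type*}

/-- Row insertion of `x`. If `x` is not smaller than any element of the row, then it is placed
at the end and nothing is bumped; otherwise it takes the place of the leftmost element `m`
larger than `x`, and `m` is bumped. Returns the new row and the bumped element, if any. -/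
def rowInsert [LinearOrder α] (x : α) : List α → List α × Option α
  | [] => ([x], none)
  | m :: r =>
      if x < m then (x :: r, some m)
      else (m :: (rowInsert x r).1, (rowInsert x r).2)

/-- Insertion of `x` into a tableau: insert `x` into the first row, and insert the bumped
element, if any, into the tableau formed by the remaining rows. Returns the new tableau and the
index (starting from `0`) of the row in which a new square was created. -/
def tableauInsert [LinearOrder α] (x : α) : List (List α) → List (List α) × ℕ
  | [] => ([[x]], 0)
  | r :: rs =>
      match rowInsert x r with
      | (s, none) => (s :: rs, 0)
      | (s, some m) => (s :: (tableauInsert m rs).1, (tableauInsert m rs).2 + 1)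

/-- Append the entry `i` to the row of index `k` (opening a new row if `k` is the number of
rows). -/
def appendAt (i : α) : ℕ → List (List α) → List (List α)
  | _, [] => [[i]]
  | 0, r :: rs => (r ++ [i]) :: rs
  | k + 1, r :: rs => r :: appendAt i k rs

end RSK

/-- One step of the RSK algorithm: insert `σ(i)` into the insertion tableau, and record `i` in
the recording tableau in the square that was created. -/
def rskStep {n : ℕ} (σ : Equiv.Perm (Fin n))
    (PQ : List (List (Fin n)) × List (List (Fin n))) (i : Fin n) :
    List (List (Fin n)) × List (List (Fin n)) :=
  ((tableauInsert (σ i) PQ.1).1, appendAt i (tableauInsert (σ i) PQ.1).2 PQ.2)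

/-- The pair `(P, Q)` of the insertion tableau and the recording tableau of `σ`. -/
def rsk {n : ℕ} (σ : Equiv.Perm (Fin n)) : List (List (Fin n)) × List (List (Fin n)) :=
  (List.finRange n).foldl (rskStep σ) ([], [])

/-! ### The Knuth map -/

/-- The word of a tableau with at most two rows: for `i` from `1` to `n`, an up-step if `i` is
on the first row, and a down-step otherwise (if `i` is on the second row). -/
def tableauWord {n : ℕ} (T : List (List (Fin n))) : List DyckStep :=
  (List.finRange n).map fun i => if i ∈ T.headD [] then DyckStep.U else DyckStep.D

/-- A step traversed in the opposite direction: up-steps become down-steps and vice versa. -/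
def reverseStep : DyckStep → DyckStep
  | DyckStep.U => DyckStep.D
  | DyckStep.D => DyckStep.U

/-- A lattice path traversed from right to left, that is, its reflection in a vertical line. -/
def backwards (w : List DyckStep) : List DyckStep := (w.map reverseStep).reverse

/-- The word of the path of `σ`: the word of `P`, followed by the word of `Q` traversed
backwards. -/
def knuthWord {n : ℕ} (σ : Equiv.Perm (Fin n)) : List DyckStep :=
  tableauWord (rsk σ).1 ++ backwards (tableauWord (rsk σ).2)

/-! ### Statistics on Dyck paths -/

/-- The height of the path above `x = k`, for `0 ≤ k ≤ 2n`. -/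
def height (p : DyckWord) (k : ℕ) : ℤ :=
  ((p.toList.take k).count DyckStep.U : ℤ) - ((p.toList.take k).count DyckStep.D : ℤ)

/-- The pair `a < b` of `x`-coordinates is that of the end points of a tunnel of the path: the
two points of the path above `x = a` and `x = b` have the same height, and the path is strictly
above the horizontal segment between them at all points in between. (As the path is linear
between consecutive lattice points, it is enough to say so at the lattice points.) -/
def IsTunnel (p : DyckWord) (a b : ℕ) : Prop :=
  a < b ∧ b ≤ p.toList.length ∧ height p a = height p b ∧
    ∀ c, a < c → c < b → height p a < height p c

/-- The number of centered tunnels: the `x`-coordinate of the midpoint is `n`. -/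
noncomputable def ct (p : DyckWord) : ℕ :=
  {t : ℕ × ℕ | IsTunnel p t.1 t.2 ∧ t.1 + t.2 = 2 * p.semilength}.ncard

/-- The number of right tunnels: the `x`-coordinate of the midpoint is greater than `n`. -/
noncomputable def rt (p : DyckWord) : ℕ :=
  {t : ℕ × ℕ | IsTunnel p t.1 t.2 ∧ 2 * p.semilength < t.1 + t.2}.ncard

/-- The height of the middle point of the path. -/
def midHeight (p : DyckWord) : ℤ := height p p.semilength

end KnuthDyck

open KnuthDyck

/-!
The proof replaces tableaux by longest increasing subsequences. Let `L(a, b)` be the length of a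
longest increasing subsequence of `σ` among the positions `< a` and the values `< b`. By Schensted's
theorem the first row of the insertion tableau, after `a` insertions, has `L(a, b)` entries `< b`
(`TwoRow.countP_lt`), so that the word of `Q` has height `2 L(t, n) - t` after `t` letters, and the
word of `P` has height `2 L(n, v) - v` after `v` letters. As `L` is symmetric under inversion of
`σ`, all that is said about `Q` and `σ` holds for `P` and `σ⁻¹`, without Schützenberger's theorem.
At the middle of the path this gives the formula for the longest increasing subsequence, and since
any set of elements of a `321`-avoiding permutation has an increasing half, both words are ballot
words, so that the path is a Dyck path.

A tunnel lies within one half, or joins an up-step of the word of `P` with an up-step of the word of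
`Q`, both unmatched in their words and at the same height. Let `p k` and `q k` be the abscissas of
the unmatched up-steps at height `k`. Then there are as many centered tunnels as `k` with
`p k = q k`, and as many right tunnels as `k` with `q k < p k` plus down-steps of the word of `Q`
(`ct_eq`, `rt_eq`). Two facts about `321`-avoiding permutations are needed.

* A down-step of the word of `Q` at `t` implies `σ(t) < t` (`apply_lt_of_down`).
* If the word of `Q` has an up-step at `t` and `σ(t) ≤ t`, then this step is unmatched, and
  `p k ≤ σ(t)` where `t = q k` (`leaves_of_up`, `rowHeight_lt_of_up`). In fact all elements to the
  right of `t` are larger than `σ(t)`, and half of them prolong an increasing subsequence that ends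
  in `σ(t)`; so neither of the words returns to the height of `t`.

Hence `σ(q k) < q k` implies `p k < q k`, symmetrically `σ⁻¹(p k) < p k` implies `q k < p k`, and a
fixed point `q k` has `p k = q k`. Counting anti-excedances, excedances and fixed points shows that
the three conditions on `σ` hold for as many `k` as there are in all, so that the three inequalities
between the numbers of `k` are equalities (`fp_and_exc_eq`).

For the bijection, row insertion into two rows is described by the relation `TwoRow`. Insertion of
the entries of `σ` never opens a third row if and only if `σ` avoids `321` (`TwoRow.of_avoids`,
`TwoRow.avoids`), it can be undone (`TwoRow.unique`), and reverse insertion succeeds on every pair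
of ballot words of the same final height (`TwoRow.exists_of_ballot`).
-/

namespace KnuthDyck

/-! ### Increasing subsequences in rectangles -/

section Rectangle

variable {n : ℕ}

theorem mem_avoiding_iff {σ : Equiv.Perm (Fin n)} :
    σ ∈ avoiding n pattern321 ↔ ∀ i j k, i < j → j < k → σ k < σ j → σ j < σ i → False := by
  constructor
  · intro h i j k hij hjk h1 h2
    refine h ⟨![i, j, k], ?_, ?_⟩
    · intro a b hab
      fin_cases a <;> fin_cases b <;> simp_all
      exact hij.trans hjk
    · intro a b
      have h3 := h1.trans h2
      fin_cases a <;> fin_cases b <;>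
        simp [pattern321, h1, h2, h3, h1.le, h2.le, h3.le]
  · rintro h ⟨f, hf, hp⟩
    refine h (f 0) (f 1) (f 2) (hf (by decide)) (hf (by decide)) ((hp 2 1).2 ?_) ((hp 1 0).2 ?_)
    · simp [pattern321]
    · simp [pattern321]

theorem inv_mem_avoiding {σ : Equiv.Perm (Fin n)} (h : σ ∈ avoiding n pattern321) :
    σ⁻¹ ∈ avoiding n pattern321 := by
  rw [mem_avoiding_iff] at h ⊢
  intro i j k hij hjk h1 h2
  exact h (σ⁻¹ k) (σ⁻¹ j) (σ⁻¹ i) h1 h2 (by simpa using hij) (by simpa using hjk)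

open Classical in
/-- The length of the longest increasing subsequence of `σ` among the positions less than `a`
and the values less than `b`. Such subsequences are encoded by their sets of positions. -/
noncomputable def lisIn (σ : Equiv.Perm (Fin n)) (a b : ℕ) : ℕ :=
  (Finset.univ.filter fun S : Finset (Fin n) =>
    StrictMonoOn σ S ∧ ∀ i ∈ S, (i : ℕ) < a ∧ (σ i : ℕ) < b).sup Finset.card

theorem card_le_lisIn {σ : Equiv.Perm (Fin n)} {a b : ℕ} {S : Finset (Fin n)}
    (hS : StrictMonoOn σ S) (h : ∀ i ∈ S, (i : ℕ) < a ∧ (σ i : ℕ) < b) :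
    S.card ≤ lisIn σ a b := by
  classical
  unfold lisIn
  exact Finset.le_sup (f := Finset.card) (by simpa using ⟨hS, h⟩)

theorem exists_card_eq_lisIn (σ : Equiv.Perm (Fin n)) (a b : ℕ) :
    ∃ S : Finset (Fin n), StrictMonoOn σ S ∧ (∀ i ∈ S, (i : ℕ) < a ∧ (σ i : ℕ) < b) ∧
      S.card = lisIn σ a b := by
  classical
  obtain ⟨S, hS, h⟩ := Finset.exists_mem_eq_sup (Finset.univ.filter fun S : Finset (Fin n) =>
    StrictMonoOn σ S ∧ ∀ i ∈ S, (i : ℕ) < a ∧ (σ i : ℕ) < b) ⟨∅, by simp [StrictMonoOn]⟩ Finset.card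
  simp only [Finset.mem_filter, Finset.mem_univ, true_and] at hS
  refine ⟨S, hS.1, hS.2, ?_⟩
  rw [lisIn, h]

theorem lisIn_mono (σ : Equiv.Perm (Fin n)) {a a' b b' : ℕ} (ha : a ≤ a') (hb : b ≤ b') :
    lisIn σ a b ≤ lisIn σ a' b' := by
  obtain ⟨S, h1, h2, h3⟩ := exists_card_eq_lisIn σ a b
  rw [← h3]
  exact card_le_lisIn h1 fun i hi => ⟨(h2 i hi).1.trans_le ha, (h2 i hi).2.trans_le hb⟩

theorem lisIn_inv_le (σ : Equiv.Perm (Fin n)) (a b : ℕ) : lisIn σ a b ≤ lisIn σ⁻¹ b a := by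
  obtain ⟨S, h1, h2, h3⟩ := exists_card_eq_lisIn σ a b
  rw [← h3, ← Finset.card_map σ.toEmbedding]
  refine card_le_lisIn ?_ ?_
  · intro x hx y hy hxy
    simp only [Finset.coe_map, Set.mem_image, Finset.mem_coe] at hx hy
    obtain ⟨i, hi, rfl⟩ := hx
    obtain ⟨j, hj, rfl⟩ := hy
    simpa using (h1.lt_iff_lt hi hj).1 hxy
  · intro x hx
    simp only [Finset.mem_map] at hx
    obtain ⟨i, hi, rfl⟩ := hx
    simpa using (h2 i hi).symm

theorem lisIn_inv (σ : Equiv.Perm (Fin n)) (a b : ℕ) : lisIn σ⁻¹ b a = lisIn σ a b :=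
  le_antisymm (by simpa using lisIn_inv_le σ⁻¹ b a) (lisIn_inv_le σ a b)

theorem lisIn_zero_left (σ : Equiv.Perm (Fin n)) (b : ℕ) : lisIn σ 0 b = 0 := by
  obtain ⟨S, -, h2, h3⟩ := exists_card_eq_lisIn σ 0 b
  rw [← h3, Finset.card_eq_zero, Finset.eq_empty_iff_forall_notMem]
  exact fun i hi => by simpa using (h2 i hi).1

theorem lisIn_succ_of_le {σ : Equiv.Perm (Fin n)} {i : Fin n} {b : ℕ} (h : b ≤ σ i) :
    lisIn σ (i + 1) b = lisIn σ i b := by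
  refine le_antisymm ?_ (lisIn_mono σ (Nat.le_succ _) le_rfl)
  obtain ⟨S, h1, h2, h3⟩ := exists_card_eq_lisIn σ (i + 1) b
  rw [← h3]
  refine card_le_lisIn h1 fun j hj => ⟨?_, (h2 j hj).2⟩
  obtain ⟨h4, h5⟩ := h2 j hj
  have : j ≠ i := by rintro rfl; omega
  have : (j : ℕ) ≠ i := fun h => this (Fin.ext h)
  omega

theorem lisIn_succ_of_lt {σ : Equiv.Perm (Fin n)} {i : Fin n} {b : ℕ} (h : σ i < b) :
    lisIn σ (i + 1) b = max (lisIn σ i b) (lisIn σ i (σ i) + 1) := by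
  classical
  apply le_antisymm
  · obtain ⟨S, h1, h2, h3⟩ := exists_card_eq_lisIn σ (i + 1) b
    rw [← h3]
    by_cases hi : i ∈ S
    · refine le_max_of_le_right ?_
      rw [← Finset.card_erase_add_one hi]
      refine Nat.succ_le_succ (card_le_lisIn (h1.mono (by simp)) fun j hj => ?_)
      obtain ⟨hj1, hj2⟩ := Finset.mem_erase.1 hj
      have h4 := (h2 j hj2).1
      have : (j : ℕ) ≠ i := fun h => hj1 (Fin.ext h)
      have hlt : j < i := by rw [Fin.lt_def]; omega
      exact ⟨hlt, h1 hj2 hi hlt⟩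
    · refine le_max_of_le_left (card_le_lisIn h1 fun j hj => ⟨?_, (h2 j hj).2⟩)
      have h4 := (h2 j hj).1
      have : (j : ℕ) ≠ i := fun h => hi (Fin.ext h ▸ hj)
      omega
  · refine max_le (lisIn_mono σ (Nat.le_succ _) le_rfl) ?_
    obtain ⟨S, h1, h2, h3⟩ := exists_card_eq_lisIn σ i (σ i)
    have hi : i ∉ S := fun hi => lt_irrefl _ (h2 i hi).1
    rw [← h3, ← Finset.card_insert_of_notMem hi]
    refine card_le_lisIn ?_ ?_
    · intro x hx y hy hxy
      simp only [Finset.coe_insert, Set.mem_insert_iff, Finset.mem_coe] at hx hy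
      rcases hx with rfl | hx <;> rcases hy with rfl | hy
      · exact absurd hxy (lt_irrefl _)
      · exact absurd hxy (not_lt.2 (Fin.le_def.2 (h2 y hy).1.le))
      · exact (h2 x hx).2
      · exact h1 hx hy hxy
    · intro j hj
      rcases Finset.mem_insert.1 hj with rfl | hj
      · exact ⟨Nat.lt_succ_self _, h⟩
      · exact ⟨(h2 j hj).1.trans (Nat.lt_succ_self _), (h2 j hj).2.trans h⟩

theorem lisIn_succ_eq_or (σ : Equiv.Perm (Fin n)) (i : Fin n) (b : ℕ) :
    lisIn σ (i + 1) b = lisIn σ i b ∨ lisIn σ (i + 1) b = lisIn σ i b + 1 := by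
  rcases le_or_gt b (σ i) with h | h
  · exact .inl (lisIn_succ_of_le h)
  · have := lisIn_mono σ (le_refl (i : ℕ)) h.le
    rw [lisIn_succ_of_lt h]
    omega

theorem lis_eq_lisIn (σ : Equiv.Perm (Fin n)) : lis σ = lisIn σ n n := by
  classical
  have hmem : ∀ m, m ∈ {m : ℕ | ∃ f : Fin m → Fin n, StrictMono f ∧ StrictMono fun k => σ (f k)} →
      m ≤ lisIn σ n n := by
    rintro m ⟨f, hf, hs⟩
    have : (Finset.univ.map ⟨f, hf.injective⟩).card = m := by simp
    rw [← this]
    refine card_le_lisIn ?_ fun i _ => ⟨i.2, (σ i).2⟩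
    intro x hx y hy hxy
    simp only [Finset.coe_map, Function.Embedding.coeFn_mk, Finset.coe_univ, Set.image_univ,
      Set.mem_range] at hx hy
    obtain ⟨i, rfl⟩ := hx
    obtain ⟨j, rfl⟩ := hy
    exact hs (hf.lt_iff_lt.1 hxy)
  refine IsGreatest.csSup_eq ⟨?_, hmem⟩
  obtain ⟨S, h1, -, h3⟩ := exists_card_eq_lisIn σ n n
  refine ⟨S.orderEmbOfFin h3, (S.orderEmbOfFin h3).strictMono, fun i j hij => ?_⟩
  exact h1 (by simp) (by simp) ((S.orderEmbOfFin h3).strictMono hij)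

/-- The left-to-right maxima of a `321`-avoiding permutation form an increasing subsequence, and
so do the other elements. -/
theorem exists_strictMonoOn_half {σ : Equiv.Perm (Fin n)} (h : σ ∈ avoiding n pattern321)
    (T : Finset (Fin n)) : ∃ S ⊆ T, StrictMonoOn σ S ∧ T.card ≤ 2 * S.card := by
  classical
  rw [mem_avoiding_iff] at h
  set p : Fin n → Prop := fun i => ∀ j < i, σ j < σ i
  have hc := Finset.card_filter_add_card_filter_not (s := T) p
  rcases le_total (T.filter fun i => ¬ p i).card (T.filter p).card with hle | hle
  · refine ⟨T.filter p, Finset.filter_subset _ _, ?_, by omega⟩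
    intro x _ y hy hxy
    simp only [Finset.coe_filter, Set.mem_ofPred_eq] at hy
    exact hy.2 x hxy
  · refine ⟨T.filter fun i => ¬ p i, Finset.filter_subset _ _, ?_, by omega⟩
    intro x hx y _ hxy
    simp only [Finset.coe_filter, Set.mem_ofPred_eq] at hx
    obtain ⟨j, hj, hjx⟩ : ∃ j < x, σ x ≤ σ j := by simpa [p] using hx.2
    by_contra hlt
    have h1 : σ y < σ x := lt_of_le_of_ne (not_lt.1 hlt) fun he => hxy.ne' (σ.injective he)
    have h2 : σ x < σ j := lt_of_le_of_ne hjx fun he => hj.ne' (σ.injective he)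
    exact h j x y hj hxy h1 h2

/-- If `σ(t) ≤ t` then either `t` is fixed and splits `σ`, or some larger value stands to the
left of `σ(t)`; in both cases no smaller value stands to its right. -/
theorem lt_of_apply_le {σ : Equiv.Perm (Fin n)} (h : σ ∈ avoiding n pattern321) {t i : Fin n}
    (ht : σ t ≤ t) (hi : t < i) : σ t < σ i := by
  classical
  rw [mem_avoiding_iff] at h
  by_contra hlt
  have h1 : σ i < σ t := lt_of_le_of_ne (not_lt.1 hlt) fun he => hi.ne' (σ.injective he)
  have hall : ∀ j < t, σ j < σ t := by
    intro j hj
    by_contra hlt'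
    have h2 : σ t < σ j := lt_of_le_of_ne (not_lt.1 hlt') fun he => hj.ne' (σ.injective he)
    exact h j t i hj hi h1 h2
  have hcard := Finset.card_le_card_of_injOn (s := insert i (Finset.Iio t))
    (t := Finset.Iio (σ t)) σ (by
      intro x hx
      simp only [Finset.coe_insert, Finset.coe_Iio, Set.mem_insert_iff, Set.mem_Iio] at hx ⊢
      rcases hx with rfl | hx
      · exact h1
      · exact hall x hx) σ.injective.injOn
  rw [Finset.card_insert_of_notMem (by simpa using hi.le), Fin.card_Iio, Fin.card_Iio] at hcard
  have := Fin.le_def.1 ht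
  omega

/-- This is `lt_of_apply_le` for `σ⁻¹`. -/
theorem lt_of_le_apply {σ : Equiv.Perm (Fin n)} (h : σ ∈ avoiding n pattern321) {t j : Fin n}
    (ht : t ≤ σ t) (hj : j < t) : σ j < σ t := by
  by_contra hlt
  have h1 : σ t < σ j := lt_of_le_of_ne (not_lt.1 hlt) fun he => hj.ne' (σ.injective he)
  have := lt_of_apply_le (inv_mem_avoiding h) (t := σ t) (i := σ j) (by simpa using ht) h1
  exact absurd (by simpa using this) hj.not_gt

/-- A step of the recording word at which no square is added to the first row is a strict
anti-excedance. -/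
theorem apply_lt_of_lisIn_succ_eq {σ : Equiv.Perm (Fin n)} (h : σ ∈ avoiding n pattern321)
    {t : Fin n} (ht : lisIn σ (t + 1) n = lisIn σ t n) : σ t < t := by
  by_contra hlt
  have hle : lisIn σ t n ≤ lisIn σ t (σ t) := by
    obtain ⟨S, h1, h2, h3⟩ := exists_card_eq_lisIn σ t n
    rw [← h3]
    exact card_le_lisIn h1 fun i hi =>
      ⟨(h2 i hi).1, lt_of_le_apply h (not_lt.1 hlt) (h2 i hi).1⟩
  rw [lisIn_succ_of_lt (σ t).2] at ht
  omega

/-- If the value `σ(t) ≤ t` is added at the end of the first row, then an increasing subsequence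
ending in `σ(t)` can be continued by any increasing subsequence to the right of `t`, and so by
at least half of the elements to the right of `t`. -/
theorem two_mul_lisIn_ge {σ : Equiv.Perm (Fin n)} (h : σ ∈ avoiding n pattern321) {t : Fin n}
    (ht : σ t ≤ t) (hup : lisIn σ (t + 1) n = lisIn σ t n + 1) {a b : ℕ} (ha : (t : ℕ) < a)
    (hb : (σ t : ℕ) < b) :
    2 * (lisIn σ t n + 1) +
      (Finset.univ.filter fun i : Fin n => t < i ∧ (i : ℕ) < a ∧ (σ i : ℕ) < b).card ≤
      2 * lisIn σ a b := by
  classical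
  obtain ⟨S, hS1, hS2, hS3⟩ := exists_card_eq_lisIn σ (t + 1) (σ t + 1)
  have hS : S.card = lisIn σ t n + 1 := by
    rw [hS3, lisIn_succ_of_lt (Nat.lt_add_one _)]
    rw [lisIn_succ_of_lt (σ t).2] at hup
    have h1 : lisIn σ t (σ t + 1) ≤ lisIn σ t n := lisIn_mono σ (le_refl (t : ℕ)) (σ t).2
    have h2 := lisIn_mono σ (le_refl (t : ℕ)) (σ t).2.le
    omega
  obtain ⟨T, hT1, hT2, hT3⟩ := exists_strictMonoOn_half h
    (Finset.univ.filter fun i : Fin n => t < i ∧ (i : ℕ) < a ∧ (σ i : ℕ) < b)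
  have hT4 : ∀ i ∈ T, t < i ∧ (i : ℕ) < a ∧ (σ i : ℕ) < b := fun i hi => by
    simpa using hT1 hi
  have hd : Disjoint S T := Finset.disjoint_left.2 fun i hi hi' => by
    have h1 := (hS2 i hi).1
    have h2 := Fin.lt_def.1 (hT4 i hi').1
    omega
  have hle : (S ∪ T).card ≤ lisIn σ a b := by
    refine card_le_lisIn ?_ ?_
    · intro x hx y hy hxy
      simp only [Finset.coe_union, Set.mem_union, Finset.mem_coe] at hx hy
      rcases hx with hx | hx <;> rcases hy with hy | hy
      · exact hS1 hx hy hxy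
      · have h1 := (hS2 x hx).2
        have h2 := Fin.lt_def.1 (lt_of_apply_le h ht (hT4 y hy).1)
        rw [Fin.lt_def]
        omega
      · have h1 := (hS2 y hy).1
        have h2 := Fin.lt_def.1 (hT4 x hx).1
        have h3 := Fin.lt_def.1 hxy
        omega
      · exact hT2 hx hy hxy
    · intro i hi
      rcases Finset.mem_union.1 hi with hi | hi
      · have := hS2 i hi
        omega
      · exact (hT4 i hi).2
  rw [Finset.card_union_of_disjoint hd] at hle
  omega

end Rectangle

/-! ### Height functions of lattice paths -/

/-- `h` is the height function, at the abscissas `0, …, n`, of a lattice path with steps `±1`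
that starts at height `0` and never goes below the axis. -/
structure IsHeight (n : ℕ) (h : ℕ → ℤ) : Prop where
  zero : h 0 = 0
  step : ∀ i < n, h (i + 1) = h i + 1 ∨ h (i + 1) = h i - 1
  nonneg : ∀ i ≤ n, 0 ≤ h i

/-- After the abscissa `t` the path stays strictly above its height at `t`. -/
def Leaves (n : ℕ) (h : ℕ → ℤ) (t : ℕ) : Prop :=
  t < n ∧ ∀ c, t < c → c ≤ n → h t < h c

theorem Leaves.inj {n : ℕ} {h : ℕ → ℤ} {t t' : ℕ} (h1 : Leaves n h t) (h2 : Leaves n h t')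
    (he : h t = h t') : t = t' := by
  rcases lt_trichotomy t t' with hlt | heq | hlt
  · have := h1.2 t' hlt h2.1.le; omega
  · exact heq
  · have := h2.2 t hlt h1.1.le; omega

namespace IsHeight

variable {n : ℕ} {h : ℕ → ℤ}

/-- The intermediate value property of lattice paths. -/
theorem exists_eq (H : IsHeight n h) {a b : ℕ} {k : ℤ} (hab : a ≤ b) (hb : b ≤ n)
    (h1 : h a ≤ k) (h2 : k ≤ h b) : ∃ c, a ≤ c ∧ c ≤ b ∧ h c = k := by
  induction b, hab using Nat.le_induction with
  | base => exact ⟨a, le_rfl, le_rfl, le_antisymm h1 h2⟩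
  | succ b hab ih =>
    by_cases hk : h (b + 1) = k
    · exact ⟨b + 1, by omega, le_rfl, hk⟩
    · have := H.step b (by omega)
      obtain ⟨c, hc1, hc2, hc3⟩ := ih (by omega) (by omega)
      exact ⟨c, hc1, by omega, hc3⟩

theorem exists_leaves (H : IsHeight n h) {k : ℕ} (hk : (k : ℤ) < h n) :
    ∃ t, Leaves n h t ∧ h t = k := by
  classical
  -- The abscissa wanted is the last one at which the height is `k`.
  obtain ⟨c, -, hc, hck⟩ := H.exists_eq (Nat.zero_le n) le_rfl (k := k) (by simp [H.zero]) hk.le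
  have hspec := Nat.findGreatest_spec (P := fun t => h t = k) hc hck
  have hle := Nat.findGreatest_le (P := fun t => h t = k) n
  have hmax := fun c => Nat.findGreatest_is_greatest (P := fun t => h t = k) (n := n) (k := c)
  set t := Nat.findGreatest (fun t => h t = k) n
  refine ⟨t, ⟨lt_of_le_of_ne hle fun he => ?_, fun c hc1 hc2 => ?_⟩, hspec⟩
  · rw [he] at hspec; omega
  · by_contra hlt
    obtain ⟨d, hd1, hd2, hd3⟩ := H.exists_eq hc2 le_rfl (k := k) (by omega) hk.le
    exact hmax d (by omega) hd2 hd3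

/-- The steps that are not matched within the path, in the order of their heights. -/
theorem exists_last (H : IsHeight n h) {m : ℕ} (hm : h n = m) : ∃ q : Fin m → Fin n,
    (∀ k, Leaves n h (q k) ∧ h (q k) = (k : ℕ)) ∧ ∀ t : ℕ, Leaves n h t → ∃ k, (q k : ℕ) = t := by
  have : ∀ k : Fin m, ∃ t : Fin n, Leaves n h t ∧ h t = (k : ℕ) := by
    intro k
    obtain ⟨t, ht⟩ := H.exists_leaves (k := k) (by have := k.2; omega)
    exact ⟨⟨t, ht.1.1⟩, ht⟩
  choose q hq using this
  refine ⟨q, hq, fun t ht => ?_⟩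
  have h0 := H.nonneg t ht.1.le
  have h1 := ht.2 n ht.1 le_rfl
  obtain ⟨k, hk⟩ := Int.eq_ofNat_of_zero_le h0
  refine ⟨⟨k, by omega⟩, ?_⟩
  obtain ⟨h2, h3⟩ := hq ⟨k, by omega⟩
  exact h2.inj ht (by simp only at h3; omega)

/-- The height of the path in terms of the number of its down-steps. -/
theorem add_two_mul_card_down (H : IsHeight n h) {t : ℕ} (ht : t ≤ n) :
    h t + 2 * ((Finset.range t).filter fun s => h (s + 1) = h s - 1).card = t := by
  induction t with
  | zero => simp [H.zero]
  | succ t ih =>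
    have h1 := ih (by omega)
    have h2 := H.step t (by omega)
    rw [Finset.range_add_one, Finset.filter_insert]
    split_ifs with hd
    · rw [Finset.card_insert_of_notMem (by simp)]
      push_cast
      omega
    · push_cast
      omega

theorem eq_add_one_of_leaves (H : IsHeight n h) {t : ℕ} (ht : Leaves n h t) :
    h (t + 1) = h t + 1 := by
  have := ht.2 (t + 1) (by omega) ht.1
  have := H.step t ht.1
  omega

/-- A horizontal chord under the path between two of its points, both at abscissas at most `n`,
is determined by its right end point, which is the end of a down-step. Every down-step arises,
because the path starts at height `0`. -/
theorem ncard_chords (H : IsHeight n h) :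
    {t : ℕ × ℕ | t.1 < t.2 ∧ t.2 ≤ n ∧ h t.1 = h t.2 ∧
      ∀ c, t.1 < c → c < t.2 → h t.2 < h c}.ncard =
    ((Finset.range n).filter fun s => h (s + 1) = h s - 1).card := by
  classical
  rw [← Set.ncard_coe_finset]
  have key : ∀ t : ℕ × ℕ, (t.1 < t.2 ∧ t.2 ≤ n ∧ h t.1 = h t.2 ∧
      ∀ c, t.1 < c → c < t.2 → h t.2 < h c) → t.1 + 1 < t.2 := by
    rintro ⟨a, b⟩ ⟨h1, h2, h3, h4⟩
    simp only at *
    by_contra hlt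
    obtain rfl : b = a + 1 := by omega
    have := H.step a (by omega)
    omega
  refine Set.ncard_congr (fun t _ => t.2 - 1) ?_ ?_ ?_
  · rintro ⟨a, b⟩ ht
    have hab := key _ ht
    obtain ⟨h1, h2, h3, h4⟩ := ht
    simp only at *
    have h5 := h4 (b - 1) (by omega) (by omega)
    have h6 := H.step (b - 1) (by omega)
    rw [Nat.sub_add_cancel (by omega)] at h6
    simp only [Finset.coe_filter, Finset.mem_range, Set.mem_ofPred_eq]
    rw [Nat.sub_add_cancel (by omega)]
    omega
  · rintro ⟨a, b⟩ ⟨a', b'⟩ ht ht' he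
    have hab := key _ ht
    have hab' := key _ ht'
    obtain ⟨h1, h2, h3, h4⟩ := ht
    obtain ⟨h1', h2', h3', h4'⟩ := ht'
    simp only at *
    obtain rfl : b = b' := by omega
    rcases lt_trichotomy a a' with hlt | rfl | hlt
    · have := h4 a' hlt h1'; omega
    · rfl
    · have := h4' a hlt h1; omega
  · intro s hs
    simp only [Finset.coe_filter, Finset.mem_range, Set.mem_ofPred_eq] at hs
    obtain ⟨hs1, hs2⟩ := hs
    -- The chord that ends with the down-step at `s` starts at the last earlier abscissa of that
    -- height.
    have hP : ∃ c ≤ s, h c = h (s + 1) := by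
      obtain ⟨c, -, hc1, hc2⟩ := H.exists_eq (a := 0) (b := s) (k := h (s + 1)) (by omega)
        (by omega) (by rw [H.zero]; exact H.nonneg _ hs1) (by omega)
      exact ⟨c, hc1, hc2⟩
    obtain ⟨c, hc1, hc2⟩ := hP
    have hspec := Nat.findGreatest_spec (P := fun t => h t = h (s + 1)) hc1 hc2
    have hle := Nat.findGreatest_le (P := fun t => h t = h (s + 1)) s
    have hmax := fun c =>
      Nat.findGreatest_is_greatest (P := fun t => h t = h (s + 1)) (n := s) (k := c)
    set t := Nat.findGreatest (fun t => h t = h (s + 1)) s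
    refine ⟨(t, s + 1), ⟨by simp; omega, hs1, hspec, fun c hc1 hc2 => ?_⟩, by simp⟩
    simp only at hc1 hc2 ⊢
    by_contra hlt
    obtain ⟨d, hd1, hd2, hd3⟩ := H.exists_eq (a := c) (b := s) (k := h (s + 1)) (by omega)
      (by omega) (by omega) (by omega)
    exact hmax d (by omega) hd2 hd3

end IsHeight

/-! ### Fixed points and excedances in terms of unmatched steps -/

section Counting

variable {n : ℕ} {σ : Equiv.Perm (Fin n)}

/-- The height at the abscissa `t` of the path given by the word of the recording tableau of `σ`.
As inversion exchanges the two tableaux, `rowHeight σ⁻¹` is the same for the insertion tableau. -/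
noncomputable def rowHeight (σ : Equiv.Perm (Fin n)) (t : ℕ) : ℤ := 2 * lisIn σ t n - t

theorem rowHeight_inv (σ : Equiv.Perm (Fin n)) (v : ℕ) :
    rowHeight σ⁻¹ v = 2 * lisIn σ n v - v := by
  rw [rowHeight, lisIn_inv]

theorem rowHeight_inv_self (σ : Equiv.Perm (Fin n)) : rowHeight σ⁻¹ n = rowHeight σ n := by
  rw [rowHeight_inv, rowHeight]

theorem le_two_mul_lisIn (h : σ ∈ avoiding n pattern321) {t : ℕ} (ht : t ≤ n) :
    t ≤ 2 * lisIn σ t n := by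
  obtain ⟨S, hS1, hS2, hS3⟩ := exists_strictMonoOn_half h
    (Finset.univ.filter fun i : Fin n => (i : ℕ) < t)
  have hc : (Finset.univ.filter fun i : Fin n => (i : ℕ) < t).card = t := by
    rw [Fin.card_filter_val_lt]; omega
  have := card_le_lisIn (a := t) (b := n) hS2 fun i hi => ⟨by simpa using hS1 hi, (σ i).2⟩
  omega

theorem isHeight_rowHeight (h : σ ∈ avoiding n pattern321) : IsHeight n (rowHeight σ) where
  zero := by simp [rowHeight, lisIn_zero_left]
  step i hi := by
    have := lisIn_succ_eq_or σ ⟨i, hi⟩ n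
    simp only [rowHeight] at *
    push_cast
    omega
  nonneg i hi := by
    have := le_two_mul_lisIn h hi
    simp only [rowHeight]
    omega

theorem lisIn_succ_eq_iff (t : Fin n) :
    lisIn σ (t + 1) n = lisIn σ t n ↔ rowHeight σ (t + 1) = rowHeight σ t - 1 := by
  have := lisIn_succ_eq_or σ t n
  simp only [rowHeight]
  push_cast
  omega

theorem apply_lt_of_down (h : σ ∈ avoiding n pattern321) {t : Fin n}
    (ht : rowHeight σ (t + 1) = rowHeight σ t - 1) : σ t < t :=
  apply_lt_of_lisIn_succ_eq h ((lisIn_succ_eq_iff t).2 ht)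

theorem le_two_mul_lisIn_of_up (h : σ ∈ avoiding n pattern321) {t : Fin n} (ht : σ t ≤ t)
    (hup : rowHeight σ (t + 1) ≠ rowHeight σ t - 1) {a b : ℕ} (ha : (t : ℕ) < a)
    (hb : (σ t : ℕ) < b) :
    2 * (lisIn σ t n + 1) +
      (Finset.univ.filter fun i : Fin n => t < i ∧ (i : ℕ) < a ∧ (σ i : ℕ) < b).card ≤
      2 * lisIn σ a b := by
  have := (lisIn_succ_eq_or σ t n).resolve_left fun he => hup ((lisIn_succ_eq_iff t).1 he)
  exact two_mul_lisIn_ge h ht this ha hb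

/-- An up-step of the recording word at an anti-excedance is never matched within the word. -/
theorem leaves_of_up (h : σ ∈ avoiding n pattern321) {t : Fin n} (ht : σ t ≤ t)
    (hup : rowHeight σ (t + 1) ≠ rowHeight σ t - 1) : Leaves n (rowHeight σ) t := by
  refine ⟨t.2, fun c hc hcn => ?_⟩
  have h1 := le_two_mul_lisIn_of_up h ht hup hc (σ t).2
  have h2 : c ≤ (t + 1) +
      (Finset.univ.filter fun i : Fin n => t < i ∧ (i : ℕ) < c ∧ (σ i : ℕ) < n).card := by
    have hc1 : (Finset.univ.filter fun i : Fin n => (i : ℕ) < c).card = c := by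
      rw [Fin.card_filter_val_lt]; omega
    rw [← Fin.card_Iic]
    refine hc1.symm.le.trans ?_
    refine (Finset.card_le_card fun i hi => ?_).trans (Finset.card_union_le _ _)
    simp only [Finset.mem_filter, Finset.mem_univ, true_and, Finset.mem_union, Finset.mem_Iic]
      at hi ⊢
    rcases le_or_gt i t with h3 | h3
    · exact .inl h3
    · exact .inr ⟨h3, hi, (σ i).2⟩
  simp only [rowHeight]
  omega

/-- An up-step of the recording word at an anti-excedance `t` lies below every part of the path
of the insertion tableau to the right of `σ(t)`: all the positions up to `t` contribute at most
`t + 1` of the values in question, and at least half of the others prolong a longest increasing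
subsequence that ends in `σ(t)`. -/
theorem rowHeight_lt_of_up (h : σ ∈ avoiding n pattern321) {t : Fin n} (ht : σ t ≤ t)
    (hup : rowHeight σ (t + 1) ≠ rowHeight σ t - 1) {v : ℕ} (hv : (σ t : ℕ) < v) (hvn : v ≤ n) :
    rowHeight σ t < rowHeight σ⁻¹ v := by
  have h1 := le_two_mul_lisIn_of_up h ht hup t.2 hv
  have h2 : v ≤ (t + 1) +
      (Finset.univ.filter fun i : Fin n => t < i ∧ (i : ℕ) < n ∧ (σ i : ℕ) < v).card := by
    have hc1 : (Finset.univ.filter fun i : Fin n => (i : ℕ) < v).card = v := by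
      rw [Fin.card_filter_val_lt]; omega
    rw [← Fin.card_Iic]
    refine (hc1.symm.trans (Finset.card_map σ⁻¹.toEmbedding).symm).le.trans ?_
    refine (Finset.card_le_card fun i hi => ?_).trans (Finset.card_union_le _ _)
    simp only [Finset.mem_map, Finset.mem_filter, Finset.mem_univ, true_and, Finset.mem_union,
      Finset.mem_Iic] at hi ⊢
    obtain ⟨j, hj, rfl⟩ := hi
    rcases le_or_gt (σ⁻¹ j) t with h3 | h3
    · exact .inl h3
    · exact .inr ⟨h3, (σ⁻¹ j).2, by simpa using hj⟩
  rw [rowHeight_inv]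
  simp only [rowHeight]
  omega

theorem card_down_fin (h : ℕ → ℤ) :
    (Finset.univ.filter fun t : Fin n => h (t + 1) = h t - 1).card =
      ((Finset.range n).filter fun s => h (s + 1) = h s - 1).card := by
  rw [← Finset.card_map Fin.valEmbedding]
  congr 1
  ext s
  simp only [Finset.mem_map, Finset.mem_filter, Finset.mem_univ, true_and, Fin.valEmbedding_apply,
    Finset.mem_range]
  constructor
  · rintro ⟨t, ht, rfl⟩
    exact ⟨t.2, ht⟩
  · rintro ⟨hs, ht⟩
    exact ⟨⟨s, hs⟩, ht, rfl⟩

theorem injective_of_height {m : ℕ} {h : ℕ → ℤ} {q : Fin m → Fin n}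
    (hq : ∀ k, h (q k) = (k : ℕ)) : Function.Injective q := by
  intro k k' hk
  have h1 := hq k
  rw [hk, hq k'] at h1
  exact Fin.ext (by omega)

/-- The strict anti-excedances are the down-steps of the recording word together with some of
its unmatched up-steps. -/
theorem card_apply_lt (h : σ ∈ avoiding n pattern321) {m : ℕ} {q : Fin m → Fin n}
    (hq : ∀ k, Leaves n (rowHeight σ) (q k) ∧ rowHeight σ (q k) = (k : ℕ))
    (hq' : ∀ t : ℕ, Leaves n (rowHeight σ) t → ∃ k, (q k : ℕ) = t) :
    (Finset.univ.filter fun t : Fin n => σ t < t).card =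
      ((Finset.range n).filter fun s => rowHeight σ (s + 1) = rowHeight σ s - 1).card +
      (Finset.univ.filter fun k => σ (q k) < q k).card := by
  classical
  have hinj : Function.Injective q := injective_of_height fun k => (hq k).2
  rw [← card_down_fin, ← Finset.card_map ⟨q, hinj⟩, ← Finset.card_union_of_disjoint]
  · congr 1
    ext t
    simp only [Finset.mem_filter, Finset.mem_univ, true_and, Finset.mem_union, Finset.mem_map,
      Function.Embedding.coeFn_mk]
    constructor
    · intro ht
      by_cases hd : rowHeight σ (t + 1) = rowHeight σ t - 1
      · exact .inl hd
      · obtain ⟨k, hk⟩ := hq' t (leaves_of_up h ht.le hd)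
        obtain rfl : q k = t := Fin.ext hk
        exact .inr ⟨k, ht, rfl⟩
    · rintro (hd | ⟨k, hk, rfl⟩)
      · exact apply_lt_of_down h hd
      · exact hk
  · refine Finset.disjoint_left.2 fun t ht ht' => ?_
    simp only [Finset.mem_filter, Finset.mem_univ, true_and, Finset.mem_map,
      Function.Embedding.coeFn_mk] at ht ht'
    obtain ⟨k, -, rfl⟩ := ht'
    have := (isHeight_rowHeight h).eq_add_one_of_leaves (hq k).1
    omega

/-- The unmatched up-steps of the recording word at fixed points. -/
theorem card_apply_eq (h : σ ∈ avoiding n pattern321) {m : ℕ} {q : Fin m → Fin n}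
    (hq : ∀ k, Leaves n (rowHeight σ) (q k) ∧ rowHeight σ (q k) = (k : ℕ))
    (hq' : ∀ t : ℕ, Leaves n (rowHeight σ) t → ∃ k, (q k : ℕ) = t) :
    fp σ = (Finset.univ.filter fun k => σ (q k) = q k).card := by
  classical
  have hinj : Function.Injective q := injective_of_height fun k => (hq k).2
  rw [fp, ← Finset.card_map ⟨q, hinj⟩]
  congr 1
  ext t
  simp only [Finset.mem_filter, Finset.mem_univ, true_and, Finset.mem_map,
    Function.Embedding.coeFn_mk]
  constructor
  · intro ht
    obtain ⟨k, hk⟩ := hq' t (leaves_of_up h ht.le fun hd => (apply_lt_of_down h hd).ne ht)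
    obtain rfl : q k = t := Fin.ext hk
    exact ⟨k, ht, rfl⟩
  · rintro ⟨k, hk, rfl⟩
    exact hk

/-- An unmatched up-step `v` of the word of the insertion tableau, at the same height as one of the
recording word at an anti-excedance `t`, is at most `σ(t)`. -/
theorem le_apply_of_height (h : σ ∈ avoiding n pattern321) {t v : Fin n}
    (ht : Leaves n (rowHeight σ) t) (hle : σ t ≤ t) (hv : rowHeight σ⁻¹ v = rowHeight σ t) :
    v ≤ σ t := by
  by_contra hlt
  have h1 := (isHeight_rowHeight h).eq_add_one_of_leaves ht
  have := rowHeight_lt_of_up h hle (by omega) (Fin.lt_def.1 (not_le.1 hlt)) v.2.le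
  omega

/-- A fixed point is an unmatched up-step at the same height in both words. -/
theorem eq_of_fixed (h : σ ∈ avoiding n pattern321) {t v : Fin n}
    (ht : Leaves n (rowHeight σ) t) (he : σ t = t) (hlv : Leaves n (rowHeight σ⁻¹) v)
    (hv : rowHeight σ⁻¹ v = rowHeight σ t) : v = t := by
  have h' := inv_mem_avoiding h
  have he' : σ⁻¹ t = t := by rw [Equiv.Perm.inv_eq_iff_eq, he]
  have hd : rowHeight σ⁻¹ (t + 1) ≠ rowHeight σ⁻¹ t - 1 :=
    fun hd => (apply_lt_of_down h' hd).ne he'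
  have hlt := leaves_of_up h' he'.le hd
  have h1 := (isHeight_rowHeight h).eq_add_one_of_leaves ht
  have h2 := (isHeight_rowHeight h').eq_add_one_of_leaves hlt
  have h3 := rowHeight_lt_of_up h he.le (by omega) (v := t + 1) (by rw [he]; omega) t.2
  have h4 := rowHeight_lt_of_up h' he'.le hd (v := t + 1) (by rw [he']; omega) t.2
  rw [inv_inv] at h4
  exact Fin.ext (hlv.inj hlt (by omega))

/-- Fixed points and excedances are read off from the heights of the two words: with the
unmatched up-steps of the two words paired by their heights, each fixed point corresponds to a
pair of equal abscissas, and each excedance to a down-step of the recording word or to a pair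
whose abscissa in the recording word is the smaller one.

The inequalities between the numbers of the three kinds of pairs and of the three kinds of
elements at unmatched steps all go in the same direction, and the totals agree. -/
theorem fp_and_exc_eq (h : σ ∈ avoiding n pattern321) {m : ℕ} (hm : rowHeight σ n = m)
    {p q : Fin m → Fin n}
    (hp : ∀ k, Leaves n (rowHeight σ⁻¹) (p k) ∧ rowHeight σ⁻¹ (p k) = (k : ℕ))
    (hp' : ∀ v : ℕ, Leaves n (rowHeight σ⁻¹) v → ∃ k, (p k : ℕ) = v)
    (hq : ∀ k, Leaves n (rowHeight σ) (q k) ∧ rowHeight σ (q k) = (k : ℕ))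
    (hq' : ∀ t : ℕ, Leaves n (rowHeight σ) t → ∃ k, (q k : ℕ) = t) :
    fp σ = (Finset.univ.filter fun k => p k = q k).card ∧
    exc σ = ((Finset.range n).filter fun s => rowHeight σ (s + 1) = rowHeight σ s - 1).card +
      (Finset.univ.filter fun k => q k < p k).card := by
  classical
  have h' := inv_mem_avoiding h
  have hA := card_apply_lt h hq hq'
  have hB := card_apply_lt h' hp hp'
  have hF := card_apply_eq h hq hq'
  have hexc : exc σ = (Finset.univ.filter fun v : Fin n => σ⁻¹ v < v).card := by
    rw [exc, ← Finset.card_map σ.toEmbedding]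
    congr 1
    ext v
    simp only [Finset.mem_map, Finset.mem_filter, Finset.mem_univ, true_and]
    constructor
    · rintro ⟨i, hi, rfl⟩
      simpa using hi
    · intro hv
      exact ⟨σ⁻¹ v, by simpa using hv, by simp⟩
  have htri : ∀ {m : ℕ} (f g : Fin m → Fin n),
      (Finset.univ.filter fun i => f i < g i).card + (Finset.univ.filter fun i => f i = g i).card +
        (Finset.univ.filter fun i => g i < f i).card = m := by
    intro m f g
    rw [← Finset.card_union_of_disjoint, ← Finset.card_union_of_disjoint]
    · conv_rhs => rw [← Finset.card_fin m]
      congr 1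
      ext i
      have := lt_trichotomy (f i) (g i)
      simpa [or_assoc] using this
    · refine Finset.disjoint_left.2 fun i hi hi' => ?_
      simp only [Finset.mem_filter, Finset.mem_univ, true_and, Finset.mem_union] at hi hi'
      rcases hi with hi | hi
      · exact hi.not_gt hi'
      · exact hi'.ne' hi
    · refine Finset.disjoint_left.2 fun i hi hi' => ?_
      simp only [Finset.mem_filter, Finset.mem_univ, true_and] at hi hi'
      exact hi.ne hi'
  have hn := htri σ id
  have hk := htri p q
  simp only [id] at hn
  have hdQ := (isHeight_rowHeight h).add_two_mul_card_down le_rfl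
  have hdP := (isHeight_rowHeight h').add_two_mul_card_down le_rfl
  rw [rowHeight_inv_self] at hdP
  have i1 : (Finset.univ.filter fun k => σ (q k) < q k).card ≤
      (Finset.univ.filter fun k => p k < q k).card := by
    refine Finset.card_le_card fun k hk => ?_
    simp only [Finset.mem_filter, Finset.mem_univ, true_and] at hk ⊢
    exact (le_apply_of_height h (hq k).1 hk.le (by rw [(hp k).2, (hq k).2])).trans_lt hk
  have i2 : (Finset.univ.filter fun k => σ⁻¹ (p k) < p k).card ≤
      (Finset.univ.filter fun k => q k < p k).card := by
    refine Finset.card_le_card fun k hk => ?_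
    simp only [Finset.mem_filter, Finset.mem_univ, true_and] at hk ⊢
    exact (le_apply_of_height h' (hp k).1 hk.le
      (by rw [inv_inv, (hp k).2, (hq k).2])).trans_lt hk
  have i3 : (Finset.univ.filter fun k => σ (q k) = q k).card ≤
      (Finset.univ.filter fun k => p k = q k).card := by
    refine Finset.card_le_card fun k hk => ?_
    simp only [Finset.mem_filter, Finset.mem_univ, true_and] at hk ⊢
    exact eq_of_fixed h (hq k).1 hk (hp k).1 (by rw [(hp k).2, (hq k).2])
  change _ + fp σ + exc σ = n at hn
  omega

end Counting

/-! ### Row insertion into two rows -/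

section Insertion

variable {α : Type*} [LinearOrder α]

/-- Inserting the entries of `xs`, of which the last one comes first, yields the first row `r₁` and
the second row `r₂`; the letters of `w`, in the same order as `xs`, say in which row each of the
squares was created. A bumped entry is required to be larger than the whole second row, so that
there is never a third one. -/
inductive TwoRow : List α → List α → List α → List DyckStep → Prop
  | nil : TwoRow [] [] [] []
  | up {x xs r₁ r₂ w} : TwoRow xs r₁ r₂ w → (∀ y ∈ r₁, y < x) →
      TwoRow (x :: xs) (r₁ ++ [x]) r₂ (DyckStep.U :: w)
  | down {x m xs a b r₂ w} : TwoRow xs (a ++ m :: b) r₂ w → (∀ y ∈ a, y < x) → x < m →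
      (∀ y ∈ r₂, y < m) → TwoRow (x :: xs) (a ++ x :: b) (r₂ ++ [m]) (DyckStep.D :: w)

namespace TwoRow

variable {xs r₁ r₂ : List α} {w : List DyckStep}

theorem perm (h : TwoRow xs r₁ r₂ w) : (r₁ ++ r₂).Perm xs := by
  induction h with
  | nil => exact List.Perm.refl _
  | @up x xs r₁ r₂ w h hx ih =>
    simpa using (List.perm_middle (a := x) (l₁ := r₁) (l₂ := r₂)).trans (ih.cons x)
  | @down x m xs a b r₂ w h ha hx hm ih =>
    rw [List.append_assoc, List.cons_append]
    refine List.perm_middle.trans (List.Perm.cons x (List.Perm.trans ?_ ih))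
    rw [List.append_assoc, List.cons_append]
    refine List.Perm.append_left a ?_
    rw [← List.append_assoc]
    exact List.perm_append_singleton m (b ++ r₂)

theorem mem_iff (h : TwoRow xs r₁ r₂ w) {y : α} : y ∈ xs ↔ y ∈ r₁ ∨ y ∈ r₂ := by
  rw [← h.perm.mem_iff, List.mem_append]

theorem sorted (h : TwoRow xs r₁ r₂ w) : r₁.Pairwise (· < ·) ∧ r₂.Pairwise (· < ·) := by
  induction h with
  | nil => simp
  | up h hx ih =>
    refine ⟨?_, ih.2⟩
    rw [List.pairwise_append]
    simpa using ⟨ih.1, hx⟩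
  | @down x m xs a b r₂ w h ha hx hm ih =>
    obtain ⟨h1, h2⟩ := ih
    simp only [List.pairwise_append, List.pairwise_cons, List.mem_cons] at h1 ⊢
    obtain ⟨h3, ⟨h4, h5⟩, h6⟩ := h1
    refine ⟨⟨h3, ⟨fun y hy => hx.trans (h4 y hy), h5⟩, ?_⟩, h2, by simp, ?_⟩
    · rintro y hy z (rfl | hz)
      · exact ha y hy
      · exact h6 y hy z (.inr hz)
    · simpa using hm

theorem length_left (h : TwoRow xs r₁ r₂ w) : r₁.length = w.count DyckStep.U := by
  induction h with
  | nil => rfl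
  | up h hx ih => simp [ih]
  | down h ha hx hm ih => simpa using ih

theorem length_word (h : TwoRow xs r₁ r₂ w) : w.length = xs.length := by
  induction h with
  | nil => rfl
  | up h hx ih => simp [ih]
  | down h ha hx hm ih => simp [ih]

theorem drop (h : TwoRow xs r₁ r₂ w) (k : ℕ) :
    ∃ s₁ s₂, TwoRow (xs.drop k) s₁ s₂ (w.drop k) := by
  induction h generalizing k with
  | nil => exact ⟨_, _, by simpa using nil⟩
  | up h hx ih =>
    cases k with
    | zero => exact ⟨_, _, up h hx⟩
    | succ k => exact ih k
  | down h ha hx hm ih =>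
    cases k with
    | zero => exact ⟨_, _, down h ha hx hm⟩
    | succ k => exact ih k

/-- If an entry `y` of the second row exceeds an entry `m` of the first one, then after `y` some
entry between them was inserted. -/
theorem exists_sublist (h : TwoRow xs r₁ r₂ w) : ∀ y ∈ r₂, ∀ m ∈ r₁, m < y →
    ∃ z, [z, y].Sublist xs ∧ m ≤ z ∧ z < y := by
  induction h with
  | nil => simp
  | @up x xs r₁ r₂ w h hx ih =>
    intro y hy m hm hmy
    rcases List.mem_append.1 hm with hm | hm
    · obtain ⟨z, hz, h1⟩ := ih y hy m hm hmy
      exact ⟨z, hz.cons _, h1⟩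
    · obtain rfl : m = x := by simpa using hm
      refine ⟨m, List.Sublist.cons_cons _ ?_, le_rfl, hmy⟩
      exact List.singleton_sublist.2 (h.mem_iff.2 (.inr hy))
  | @down x m' xs a b r₂ w h ha hx hm' ih =>
    intro y hy m hm hmy
    have hyx : y ∈ xs := by
      rcases List.mem_append.1 hy with hy | hy
      · exact h.mem_iff.2 (.inr hy)
      · obtain rfl : y = m' := by simpa using hy
        exact h.mem_iff.2 (.inl (by simp))
    have hsub : [x, y].Sublist (x :: xs) :=
      List.Sublist.cons_cons _ (List.singleton_sublist.2 hyx)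
    have hs := h.sorted.1
    simp only [List.pairwise_append, List.pairwise_cons] at hs
    rcases List.mem_append.1 hy with hy | hy
    · rcases List.mem_append.1 hm with hm | hm
      · obtain ⟨z, hz, h1⟩ := ih y hy m (by simp [hm]) hmy
        exact ⟨z, hz.cons _, h1⟩
      · rcases List.mem_cons.1 hm with rfl | hm
        · exact ⟨m, hsub, le_rfl, hmy⟩
        · obtain ⟨z, hz, h1⟩ := ih y hy m (by simp [hm]) hmy
          exact ⟨z, hz.cons _, h1⟩
    · obtain rfl : y = m' := by simpa using hy
      refine ⟨x, hsub, ?_, hx⟩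
      rcases List.mem_append.1 hm with hm | hm
      · exact (ha m hm).le
      · rcases List.mem_cons.1 hm with rfl | hm
        · exact le_rfl
        · exact absurd hmy (hs.2.1.1 m hm).not_gt

end TwoRow

theorem rowInsert_of_forall_lt {x : α} {r : List α} (h : ∀ y ∈ r, y < x) :
    rowInsert x r = (r ++ [x], none) := by
  induction r with
  | nil => rfl
  | cons m r ih =>
    simp only [List.mem_cons, forall_eq_or_imp] at h
    simp [rowInsert, h.1.not_gt, ih h.2]

theorem rowInsert_of_lt {x m : α} {a b : List α} (ha : ∀ y ∈ a, y < x) (hx : x < m) :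
    rowInsert x (a ++ m :: b) = (a ++ x :: b, some m) := by
  induction a with
  | nil => simp [rowInsert, hx]
  | cons c a ih =>
    simp only [List.mem_cons, forall_eq_or_imp] at ha
    simp [rowInsert, ha.1.not_gt, ih ha.2]

theorem forall_lt_or_exists_split {x : α} {r : List α} (hr : r.Pairwise (· < ·)) (hx : x ∉ r) :
    (∀ y ∈ r, y < x) ∨ ∃ a m b, r = a ++ m :: b ∧ (∀ y ∈ a, y < x) ∧ x < m := by
  induction r with
  | nil => simp
  | cons c r ih =>
    rw [List.pairwise_cons] at hr
    simp only [List.mem_cons, not_or] at hx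
    rcases lt_or_gt_of_ne hx.1 with h | h
    · exact .inr ⟨[], c, r, rfl, by simp, h⟩
    · rcases ih hr.2 hx.2 with h1 | ⟨a, m, b, rfl, h1, h2⟩
      · left
        simpa using ⟨h, h1⟩
      · exact .inr ⟨c :: a, m, b, rfl, by simpa using ⟨h, h1⟩, h2⟩

/-- The list contains no decreasing sequence of length three when read from right to left. -/
def Avoids321 (xs : List α) : Prop :=
  ∀ a b c, [c, b, a].Sublist xs → c < b → b < a → False

/-- Insertion of a sequence without `321` never opens a third row: if `x` bumped some `m` that is
smaller than an entry `y` of the second row, then `y`, some `z ≥ m` and `x` would form a `321`. -/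
theorem TwoRow.of_avoids {xs : List α} (hn : xs.Nodup) (h : Avoids321 xs) :
    ∃ r₁ r₂ w, TwoRow xs r₁ r₂ w := by
  induction xs with
  | nil => exact ⟨_, _, _, .nil⟩
  | cons x xs ih =>
    rw [List.nodup_cons] at hn
    obtain ⟨r₁, r₂, w, hT⟩ := ih hn.2 fun a b c hs => h a b c (hs.cons _)
    have hx : x ∉ r₁ := fun hx => hn.1 (hT.mem_iff.2 (.inl hx))
    rcases forall_lt_or_exists_split hT.sorted.1 hx with h1 | ⟨a, m, b, rfl, h1, h2⟩
    · exact ⟨_, _, _, .up hT h1⟩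
    · refine ⟨_, _, _, .down hT h1 h2 fun y hy => ?_⟩
      by_contra hlt
      have hne : m ≠ y := by
        rintro rfl
        have := hT.perm.nodup_iff.2 hn.2
        rw [List.nodup_append] at this
        exact this.2.2 m (by simp) m hy rfl
      obtain ⟨z, hz, hz1, hz2⟩ := hT.exists_sublist y hy m (by simp)
        (lt_of_le_of_ne (not_lt.1 hlt) hne)
      exact h y z x (hz.cons_cons _) (h2.trans_le hz1) hz2

/-- The smaller element of an inversion stays in the first row, since the second row has an entry
larger than it, and only larger entries can follow there. -/
theorem TwoRow.inversion {xs r₁ r₂ : List α} {w : List DyckStep} (h : TwoRow xs r₁ r₂ w) :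
    ∀ a b, [b, a].Sublist xs → b < a → b ∈ r₁ ∧ ∃ m ∈ r₂, b < m := by
  induction h with
  | nil => simp
  | @up x xs r₁ r₂ w h hx ih =>
    intro a b hs hba
    cases hs with
    | cons _ hs =>
      obtain ⟨h1, h2⟩ := ih a b hs hba
      exact ⟨by simp [h1], h2⟩
    | cons_cons _ hs =>
      rcases h.mem_iff.1 (List.singleton_sublist.1 hs) with h1 | h1
      · exact absurd (hx a h1) hba.not_gt
      · exact ⟨by simp, a, h1, hba⟩
  | @down x m xs r s r₂ w h hr hx hm ih =>
    intro a b hs hba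
    cases hs with
    | cons _ hs =>
      obtain ⟨h1, m', h2, h3⟩ := ih a b hs hba
      refine ⟨?_, m', by simp [h2], h3⟩
      have : b ≠ m := by
        rintro rfl
        exact absurd (hm m' h2) h3.not_gt
      simp only [List.mem_append, List.mem_cons] at h1 ⊢
      tauto
    | cons_cons _ hs => exact ⟨by simp, m, by simp, hx⟩

theorem TwoRow.avoids {xs r₁ r₂ : List α} {w : List DyckStep} (h : TwoRow xs r₁ r₂ w) :
    Avoids321 xs := by
  induction h with
  | nil => intro a b c hs; simp at hs
  | @up x xs r₁ r₂ w h hx ih =>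
    intro a b c hs hcb hba
    cases hs with
    | cons _ hs => exact ih a b c hs hcb hba
    | cons_cons _ hs => exact (hx b (h.inversion a b hs hba).1).not_gt hcb
  | @down x m xs r s r₂ w h hr hx hm ih =>
    intro a b c hs hcb hba
    cases hs with
    | cons _ hs => exact ih a b c hs hcb hba
    | cons_cons _ hs =>
      obtain ⟨h1, m', h2, h3⟩ := h.inversion a b hs hba
      have h4 := h3.trans (hm m' h2)
      have hs := h.sorted.1
      simp only [List.pairwise_append, List.pairwise_cons] at hs
      simp only [List.mem_append, List.mem_cons] at h1
      rcases h1 with h1 | rfl | h1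
      · exact (hr b h1).not_gt hcb
      · exact lt_irrefl _ h4
      · exact (hs.2.1.1 b h1).not_gt h4

/-- A sorted row splits in one way at the last of its entries smaller than `m`. -/
theorem split_unique {a b a' b' : List α} {x x' m : α} (h : a ++ x :: b = a' ++ x' :: b')
    (ha : x < m) (hb : ∀ y ∈ b, m < y) (ha' : x' < m) (hb' : ∀ y ∈ b', m < y) :
    a = a' ∧ x = x' ∧ b = b' := by
  rcases List.append_eq_append_iff.1 h with ⟨c, h1, h2⟩ | ⟨c, h1, h2⟩
  · cases c with
    | nil => simp_all
    | cons y c =>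
      simp only [List.cons_append, List.cons.injEq] at h2
      exact absurd (hb x' (by simp [h2.2])) ha'.not_gt
  · cases c with
    | nil => simp_all
    | cons y c =>
      simp only [List.cons_append, List.cons.injEq] at h2
      exact absurd (hb' x (by simp [h2.2])) ha.not_gt

/-- Row insertion into two rows can be undone. -/
theorem TwoRow.unique {xs xs' r₁ r₂ : List α} {w : List DyckStep} (h : TwoRow xs r₁ r₂ w)
    (h' : TwoRow xs' r₁ r₂ w) : xs = xs' := by
  induction h generalizing xs' with
  | nil => simpa using h'.perm
  | @up x xs r₁ r₂ w h hx ih =>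
    generalize hr : r₁ ++ [x] = r at h'
    cases h' with
    | @up x' xs' r' _ _ h' hx' =>
      obtain ⟨rfl, h2⟩ := List.append_inj' hr rfl
      obtain rfl : x = x' := by simpa using h2
      rw [ih h']
  | @down x m xs a b r₂ w h ha hx hm ih =>
    generalize hr : a ++ x :: b = r at h'
    generalize hs : r₂ ++ [m] = s at h'
    cases h' with
    | @down x' m' xs' a' b' r' _ h' ha' hx' hm' =>
      obtain ⟨rfl, h2⟩ := List.append_inj' hs rfl
      obtain rfl : m = m' := by simpa using h2
      have h3 := h.sorted.1
      have h4 := h'.sorted.1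
      simp only [List.pairwise_append, List.pairwise_cons] at h3 h4
      obtain ⟨rfl, rfl, rfl⟩ := split_unique hr hx h3.2.1.1 hx' h4.2.1.1
      rw [ih h']

/-- Reverse row insertion succeeds on every pair of a standard tableau with at most two rows (here
in terms of the numbers of entries that do not exceed a given one) and a ballot word. -/
theorem TwoRow.exists_of_ballot {r₁ r₂ : List α} {w : List DyckStep}
    (h₁ : r₁.Pairwise (· < ·)) (h₂ : r₂.Pairwise (· < ·)) (hd : ∀ y ∈ r₁, y ∉ r₂)
    (hc : ∀ v, r₂.countP (· ≤ v) ≤ r₁.countP (· ≤ v))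
    (hl₁ : r₁.length = w.count DyckStep.U) (hl₂ : r₂.length = w.count DyckStep.D)
    (hw : ∀ k, (w.drop k).count DyckStep.D ≤ (w.drop k).count DyckStep.U) :
    ∃ xs, TwoRow xs r₁ r₂ w := by
  induction w generalizing r₁ r₂ with
  | nil =>
    obtain rfl : r₁ = [] := List.length_eq_zero_iff.1 (by simpa using hl₁)
    obtain rfl : r₂ = [] := List.length_eq_zero_iff.1 (by simpa using hl₂)
    exact ⟨_, .nil⟩
  | cons s w ih =>
    have hw' : ∀ k, (w.drop k).count DyckStep.D ≤ (w.drop k).count DyckStep.U :=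
      fun k => by simpa using hw (k + 1)
    have hw0 := hw' 0
    simp only [List.drop_zero] at hw0
    cases s with
    | U =>
      have hne : r₁ ≠ [] := by
        rintro rfl
        simp at hl₁
      obtain ⟨r, x, rfl⟩ : ∃ r x, r₁ = r ++ [x] := ⟨_, _, (List.dropLast_append_getLast hne).symm⟩
      have hl₁' : r.length = w.count DyckStep.U := by simpa using hl₁
      have hl₂' : r₂.length = w.count DyckStep.D := by simpa using hl₂
      rw [List.pairwise_append] at h₁
      have hrx : ∀ y ∈ r, y < x := fun y hy => h₁.2.2 y hy x (by simp)
      obtain ⟨xs, hT⟩ := ih h₁.1 h₂ (fun y hy => hd y (by simp [hy])) (fun v => by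
        have hv := hc v
        by_cases hxv : x ≤ v
        · have h3 : r.countP (· ≤ v) = r.length :=
            List.countP_eq_length.2 fun y hy => by simpa using (hrx y hy).le.trans hxv
          have h4 := List.countP_le_length (p := fun y => decide (y ≤ v)) (l := r₂)
          omega
        · simpa [List.countP_append, hxv] using hv) hl₁' hl₂' hw'
      exact ⟨_, .up hT hrx⟩
    | D =>
      have hne : r₂ ≠ [] := by
        rintro rfl
        simp at hl₂
      obtain ⟨r, m, rfl⟩ : ∃ r m, r₂ = r ++ [m] := ⟨_, _, (List.dropLast_append_getLast hne).symm⟩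
      have hl₁' : r₁.length = w.count DyckStep.U := by simpa using hl₁
      have hl₂' : r.length = w.count DyckStep.D := by simpa using hl₂
      rw [List.pairwise_append] at h₂
      have hrm : ∀ y ∈ r, y < m := fun y hy => h₂.2.2 y hy m (by simp)
      have hm₁ : m ∉ r₁ := fun hm => hd m hm (by simp)
      -- The entry to be removed is the largest one of the first row that is smaller than `m`.
      obtain ⟨a, x, b, rfl, hxm, hbm⟩ :
          ∃ a x b, r₁ = a ++ x :: b ∧ x < m ∧ ∀ y ∈ b, m < y := by
        rcases forall_lt_or_exists_split h₁ hm₁ with h3 | ⟨a, m', b, rfl, h3, h4⟩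
        · have hne' : r₁ ≠ [] := by
            rintro rfl
            have := hc m
            simp at this
          obtain ⟨a, x, rfl⟩ : ∃ a x, r₁ = a ++ [x] :=
            ⟨_, _, (List.dropLast_append_getLast hne').symm⟩
          exact ⟨a, x, [], rfl, h3 x (by simp), by simp⟩
        · simp only [List.pairwise_append, List.pairwise_cons] at h₁
          have h5 : ∀ y ∈ m' :: b, m < y := by
            intro y hy
            rcases List.mem_cons.1 hy with rfl | hy
            · exact h4
            · exact h4.trans (h₁.2.1.1 y hy)
          have hne' : a ≠ [] := by
            rintro rfl
            have h6 := hc m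
            have h7 : (m' :: b).countP (· ≤ m) = 0 :=
              List.countP_eq_zero.2 fun y hy => by simpa using h5 y hy
            rw [List.nil_append, h7] at h6
            simp at h6
          obtain ⟨a, x, rfl⟩ : ∃ a' x, a = a' ++ [x] :=
            ⟨_, _, (List.dropLast_append_getLast hne').symm⟩
          exact ⟨a, x, m' :: b, by simp, h3 x (by simp), h5⟩
      simp only [List.pairwise_append, List.pairwise_cons, List.mem_cons] at h₁
      obtain ⟨h3, ⟨h4, h5⟩, h6⟩ := h₁
      have hax : ∀ y ∈ a, y < x := fun y hy => h6 y hy x (.inl rfl)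
      have hlen : r.length ≤ a.length := by
        have h7 := hc m
        have h8 : r.countP (· ≤ m) = r.length :=
          List.countP_eq_length.2 fun y hy => by simpa using (hrm y hy).le
        have h9 : a.countP (· ≤ m) = a.length :=
          List.countP_eq_length.2 fun y hy => by simpa using ((hax y hy).trans hxm).le
        have h10 : b.countP (· ≤ m) = 0 :=
          List.countP_eq_zero.2 fun y hy => by simpa using hbm y hy
        rw [List.countP_append, List.countP_append, List.countP_cons, List.countP_cons, h8, h9,
          h10] at h7
        simpa [hxm.le] using h7
      obtain ⟨xs, hT⟩ := ih (r₁ := a ++ m :: b) (r₂ := r)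
        (by
          simp only [List.pairwise_append, List.pairwise_cons, List.mem_cons]
          refine ⟨h3, ⟨hbm, h5⟩, ?_⟩
          rintro y hy z (rfl | hz)
          · exact (hax y hy).trans hxm
          · exact h6 y hy z (.inr hz))
        h₂.1
        (by
          intro y hy hyr
          simp only [List.mem_append, List.mem_cons] at hy
          rcases hy with hy | rfl | hy
          · exact hd y (by simp [hy]) (by simp [hyr])
          · exact lt_irrefl _ (hrm y hyr)
          · exact hd y (by simp [hy]) (by simp [hyr]))
        (by
          intro v
          have hv := hc v
          simp only [List.countP_append, List.countP_cons, decide_eq_true_eq, List.countP_nil]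
            at hv ⊢
          by_cases hmv : m ≤ v
          · simp only [hmv, hxm.le.trans hmv, if_true] at hv ⊢
            omega
          · by_cases hxv : x ≤ v
            · have h7 : a.countP (· ≤ v) = a.length :=
                List.countP_eq_length.2 fun y hy => by simpa using (hax y hy).le.trans hxv
              have h8 := List.countP_le_length (p := fun y => decide (y ≤ v)) (l := r)
              omega
            · simp only [hmv, hxv, if_false] at hv ⊢
              omega)
        (by simpa using hl₁') hl₂' hw'
      exact ⟨_, .down hT hax hxm hrm⟩

end Insertion

/-! ### Tunnels -/

section Tunnels

variable {n m : ℕ} {D : DyckWord} {f g : ℕ → ℤ} {p q : Fin m → Fin n}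

/-- The tunnels that start in the left half and end in the right half join an unmatched up-step
of the left half with one of the reversed right half, at the same height. -/
theorem exists_of_isTunnel (hD : D.toList.length = 2 * n)
    (hf : ∀ v ≤ n, height D v = f v) (hg : ∀ t ≤ n, height D (2 * n - t) = g t)
    (hp : ∀ k, Leaves n f (p k) ∧ f (p k) = (k : ℕ))
    (hp' : ∀ v : ℕ, Leaves n f v → ∃ k, (p k : ℕ) = v)
    (hq : ∀ k, Leaves n g (q k) ∧ g (q k) = (k : ℕ))
    (hq' : ∀ t : ℕ, Leaves n g t → ∃ k, (q k : ℕ) = t)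
    {a b : ℕ} (h : IsTunnel D a b) (ha : a < n) (hb : n < b) :
    ∃ k, (p k : ℕ) = a ∧ 2 * n - (q k : ℕ) = b := by
  obtain ⟨h1, h2, h3, h4⟩ := h
  rw [hD] at h2
  have hgb := hg (2 * n - b) (by omega)
  rw [show 2 * n - (2 * n - b) = b by omega] at hgb
  have hLa : Leaves n f a := ⟨ha, fun c hc hcn => by
    rw [← hf a ha.le, ← hf c hcn]
    exact h4 c hc (by omega)⟩
  have hLb : Leaves n g (2 * n - b) := ⟨by omega, fun c hc hcn => by
    rw [← hgb, ← hg c hcn, ← h3]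
    exact h4 _ (by omega) (by omega)⟩
  obtain ⟨k, hk⟩ := hp' a hLa
  obtain ⟨l, hl⟩ := hq' _ hLb
  have hkl : k = l := by
    have hk1 := (hp k).2
    have hl1 := (hq l).2
    rw [hk, ← hf a ha.le] at hk1
    rw [hl, ← hgb] at hl1
    exact Fin.ext (by omega)
  subst hkl
  exact ⟨k, hk, by omega⟩

theorem isTunnel_pair (hD : D.toList.length = 2 * n)
    (hf : ∀ v ≤ n, height D v = f v) (hg : ∀ t ≤ n, height D (2 * n - t) = g t)
    (hp : ∀ k, Leaves n f (p k) ∧ f (p k) = (k : ℕ))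
    (hq : ∀ k, Leaves n g (q k) ∧ g (q k) = (k : ℕ)) (k : Fin m) :
    IsTunnel D (p k) (2 * n - q k) := by
  have h1 := (p k).2
  have h2 := (q k).2
  refine ⟨by omega, by omega, ?_, fun c hc1 hc2 => ?_⟩
  · rw [hf _ h1.le, hg _ h2.le, (hp k).2, (hq k).2]
  · rcases le_or_gt c n with hc | hc
    · rw [hf _ h1.le, hf _ hc]
      exact (hp k).1.2 c hc1 hc
    · have hgc := hg (2 * n - c) (by omega)
      rw [show 2 * n - (2 * n - c) = c by omega] at hgc
      rw [hf _ h1.le, hgc, (hp k).2, ← (hq k).2]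
      exact (hq k).1.2 _ (by omega) (by omega)

theorem ncard_pairs (hp : ∀ k, f (p k) = (k : ℕ)) (P : Fin m → Prop) [DecidablePred P] :
    {t : ℕ × ℕ | ∃ k, P k ∧ t = ((p k : ℕ), 2 * n - (q k : ℕ))}.ncard =
      (Finset.univ.filter P).card := by
  rw [← Set.ncard_coe_finset]
  symm
  refine Set.ncard_congr (fun k _ => ((p k : ℕ), 2 * n - (q k : ℕ))) ?_ ?_ ?_
  · intro k hk
    exact ⟨k, by simpa using hk, rfl⟩
  · intro k l _ _ h
    exact injective_of_height hp (Fin.ext (Prod.ext_iff.1 h).1)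
  · rintro t ⟨k, hk, rfl⟩
    exact ⟨k, by simpa using hk, rfl⟩

theorem ct_eq (hD : D.toList.length = 2 * n)
    (hf : ∀ v ≤ n, height D v = f v) (hg : ∀ t ≤ n, height D (2 * n - t) = g t)
    (hp : ∀ k, Leaves n f (p k) ∧ f (p k) = (k : ℕ))
    (hp' : ∀ v : ℕ, Leaves n f v → ∃ k, (p k : ℕ) = v)
    (hq : ∀ k, Leaves n g (q k) ∧ g (q k) = (k : ℕ))
    (hq' : ∀ t : ℕ, Leaves n g t → ∃ k, (q k : ℕ) = t) (hs : D.semilength = n) :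
    ct D = (Finset.univ.filter fun k => p k = q k).card := by
  rw [ct, ← ncard_pairs (q := q) (fun k => (hp k).2), hs]
  congr 1
  ext ⟨a, b⟩
  simp only [Set.mem_ofPred_eq, Prod.mk.injEq]
  constructor
  · rintro ⟨h, hab⟩
    have h1 := h.1
    obtain ⟨k, hk1, hk2⟩ :=
      exists_of_isTunnel hD hf hg hp hp' hq hq' h (by omega) (by omega)
    have := (q k).2
    exact ⟨k, Fin.ext (by omega), hk1.symm, hk2.symm⟩
  · rintro ⟨k, hk, rfl, rfl⟩
    have := (q k).2
    refine ⟨isTunnel_pair hD hf hg hp hq k, ?_⟩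
    rw [hk]
    omega

/-- A right tunnel lies in the right half, or joins the two halves. -/
theorem rt_eq (hD : D.toList.length = 2 * n) (hG : IsHeight n g)
    (hf : ∀ v ≤ n, height D v = f v) (hg : ∀ t ≤ n, height D (2 * n - t) = g t)
    (hp : ∀ k, Leaves n f (p k) ∧ f (p k) = (k : ℕ))
    (hp' : ∀ v : ℕ, Leaves n f v → ∃ k, (p k : ℕ) = v)
    (hq : ∀ k, Leaves n g (q k) ∧ g (q k) = (k : ℕ))
    (hq' : ∀ t : ℕ, Leaves n g t → ∃ k, (q k : ℕ) = t) (hs : D.semilength = n) :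
    rt D = ((Finset.range n).filter fun s => g (s + 1) = g s - 1).card +
      (Finset.univ.filter fun k => q k < p k).card := by
  rw [rt, ← ncard_pairs (q := q) (fun k => (hp k).2), hs, ← hG.ncard_chords]
  have hinj : Set.InjOn (fun t : ℕ × ℕ => (2 * n - t.2, 2 * n - t.1))
      {t : ℕ × ℕ | t.1 < t.2 ∧ t.2 ≤ n ∧ g t.1 = g t.2 ∧
        ∀ c, t.1 < c → c < t.2 → g t.2 < g c} := by
    rintro ⟨a, b⟩ h ⟨a', b'⟩ h' he
    have h1 := h.1
    have h2 := h.2.1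
    have h3 := h'.1
    have h4 := h'.2.1
    simp only [Prod.mk.injEq] at *
    omega
  have hfin : {t : ℕ × ℕ | t.1 < t.2 ∧ t.2 ≤ n ∧ g t.1 = g t.2 ∧
        ∀ c, t.1 < c → c < t.2 → g t.2 < g c}.Finite := by
    refine ((Set.finite_Iic n).prod (Set.finite_Iic n)).subset ?_
    rintro ⟨a, b⟩ h
    have h1 := h.1
    have h2 := h.2.1
    simp only [Set.mem_prod, Set.mem_Iic] at *
    omega
  have hfin' : {t : ℕ × ℕ | ∃ k, q k < p k ∧ t = ((p k : ℕ), 2 * n - (q k : ℕ))}.Finite := by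
    refine (Set.finite_range fun k => ((p k : ℕ), 2 * n - (q k : ℕ))).subset ?_
    rintro t ⟨k, -, rfl⟩
    exact ⟨k, rfl⟩
  rw [← hinj.ncard_image, ← Set.ncard_union_eq ?_ (hfin.image _) hfin']
  · congr 1
    ext ⟨a, b⟩
    simp only [Set.mem_ofPred_eq, Set.mem_union, Set.mem_image, Prod.mk.injEq, Prod.exists]
    constructor
    · rintro ⟨h, hab⟩
      rcases lt_or_ge a n with ha | ha
      · obtain ⟨k, hk1, hk2⟩ := exists_of_isTunnel hD hf hg hp hp' hq hq' h ha (by omega)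
        have := (q k).2
        exact .inr ⟨k, Fin.lt_def.2 (by omega), hk1.symm, hk2.symm⟩
      · obtain ⟨h1, h2, h3, h4⟩ := h
        rw [hD] at h2
        have key : ∀ c, n ≤ c → c ≤ 2 * n → height D c = g (2 * n - c) := by
          intro c hc1 hc2
          rw [← hg (2 * n - c) (by omega), show 2 * n - (2 * n - c) = c by omega]
        left
        refine ⟨2 * n - b, 2 * n - a, ⟨by omega, by omega, ?_, fun c hc1 hc2 => ?_⟩,
          by omega, by omega⟩
        · rw [← key a ha (by omega), ← key b (by omega) h2, h3]
        · rw [← key a ha (by omega), ← hg c (by omega)]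
          exact h4 _ (by omega) (by omega)
    · rintro (⟨s, t, ⟨h1, h2, h3, h4⟩, rfl, rfl⟩ | ⟨k, hk, rfl, rfl⟩)
      · refine ⟨⟨by omega, by omega, ?_, fun c hc1 hc2 => ?_⟩, by omega⟩
        · rw [hg t h2, hg s (by omega), h3]
        · rw [hg t h2, show c = 2 * n - (2 * n - c) by omega, hg _ (by omega)]
          exact h4 _ (by omega) (by omega)
      · have := (q k).2
        have := Fin.lt_def.1 hk
        exact ⟨isTunnel_pair hD hf hg hp hq k, by omega⟩
  · refine Set.disjoint_left.2 ?_
    rintro x ⟨⟨s, t⟩, ⟨h1, h2, -, -⟩, rfl⟩ ⟨k, -, h⟩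
    have := (p k).2
    simp only [Prod.mk.injEq] at h h1 h2
    omega

end Tunnels

/-! ### The words of the two tableaux -/

section Words

variable {n : ℕ}

/-- The entries `σ(1), …, σ(n)`, the last one first. -/
def entries (σ : Equiv.Perm (Fin n)) : List (Fin n) := ((List.finRange n).map σ).reverse

theorem nodup_entries (σ : Equiv.Perm (Fin n)) : (entries σ).Nodup :=
  List.nodup_reverse.2 ((List.nodup_finRange n).map σ.injective)

theorem mem_entries (σ : Equiv.Perm (Fin n)) (i : Fin n) : i ∈ entries σ := by
  simp only [entries, List.mem_reverse, List.mem_map, List.mem_finRange, true_and]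
  exact σ.surjective i

theorem length_entries (σ : Equiv.Perm (Fin n)) : (entries σ).length = n := by
  simp [entries]

theorem entries_injective : Function.Injective (entries (n := n)) := by
  intro σ τ h
  have h1 := List.reverse_injective h
  ext i
  rw [List.map_inj_left.1 h1 i (List.mem_finRange i)]

theorem mem_avoiding_iff_avoids321 {σ : Equiv.Perm (Fin n)} :
    σ ∈ avoiding n pattern321 ↔ Avoids321 (entries σ) := by
  rw [mem_avoiding_iff]
  constructor
  · intro h a b c hs hcb hba
    have hs' : [a, b, c].Sublist ((List.finRange n).map σ) := by
      simpa [entries] using hs.reverse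
    obtain ⟨l, hl, he⟩ := List.sublist_map_iff.1 hs'
    have hp := (List.pairwise_lt_finRange n).sublist hl
    match l, he with
    | [i, j, k], he =>
      simp only [List.map_cons, List.map_nil, List.cons.injEq, and_true] at he
      obtain ⟨rfl, rfl, rfl⟩ := he
      simp only [List.pairwise_cons, List.mem_cons, forall_eq_or_imp] at hp
      exact h i j k hp.1.1 hp.2.1.1 hcb hba
  · intro h i j k hij hjk h1 h2
    refine h (σ i) (σ j) (σ k) ?_ h1 h2
    have hs : [i, j, k].Sublist (List.finRange n) := by
      have hp : [i, j, k].Pairwise (· < ·) := by simp [hij, hjk, hij.trans hjk]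
      exact List.sublist_of_subperm_of_pairwise
        (List.subperm_of_subset (hp.imp ne_of_lt) fun x _ => List.mem_finRange x) hp
        (List.pairwise_lt_finRange n)
    simpa [entries] using (hs.map σ).reverse

/-- The tableau with the rows `r₁` and `r₂`; empty rows are left out at the end. -/
def rows {α : Type*} : List α → List α → List (List α)
  | [], [] => []
  | r₁, [] => [r₁]
  | r₁, r₂ => [r₁, r₂]

theorem rows_cons {α : Type*} (r : List α) (b : α) (s : List α) :
    rows r (b :: s) = [r, b :: s] := by
  cases r <;> rfl

theorem rows_of_ne_nil {α : Type*} {r₁ r₂ : List α} (h : r₂ ≠ []) : rows r₁ r₂ = [r₁, r₂] := by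
  cases r₂ with
  | nil => exact absurd rfl h
  | cons b s => exact rows_cons r₁ b s

theorem rows_nil_of_ne_nil {α : Type*} {r : List α} (h : r ≠ []) : rows r [] = [r] := by
  cases r with
  | nil => exact absurd rfl h
  | cons b s => rfl

theorem headD_rows {α : Type*} (r₁ r₂ : List α) : (rows r₁ r₂).headD [] = r₁ := by
  cases r₁ <;> cases r₂ <;> rfl

theorem length_rows_le {α : Type*} (r₁ r₂ : List α) : (rows r₁ r₂).length ≤ 2 := by
  cases r₁ <;> cases r₂ <;> simp [rows]

theorem tableauInsert_rows_of_forall_lt {α : Type*} [LinearOrder α] {x : α} {r₁ r₂ : List α}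
    (h : ∀ y ∈ r₁, y < x) : tableauInsert x (rows r₁ r₂) = (rows (r₁ ++ [x]) r₂, 0) := by
  have h1 := rowInsert_of_forall_lt h
  cases r₂ with
  | nil =>
    cases r₁ with
    | nil => rfl
    | cons a r => simp [rows, tableauInsert, h1]
  | cons b s => simp [rows_cons, tableauInsert, h1]

theorem tableauInsert_rows_of_lt {α : Type*} [LinearOrder α] {x m : α} {a b r₂ : List α}
    (ha : ∀ y ∈ a, y < x) (hx : x < m) (hm : ∀ y ∈ r₂, y < m) :
    tableauInsert x (rows (a ++ m :: b) r₂) = (rows (a ++ x :: b) (r₂ ++ [m]), 1) := by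
  have h1 := rowInsert_of_lt (b := b) ha hx
  rw [rows_of_ne_nil (r₂ := r₂ ++ [m]) (by simp)]
  by_cases hr : r₂ = []
  · subst hr
    rw [rows_nil_of_ne_nil (by simp)]
    simp [tableauInsert, h1]
  · rw [rows_of_ne_nil hr]
    simp [tableauInsert, h1, rowInsert_of_forall_lt hm]

theorem appendAt_zero_rows {α : Type*} (i : α) (q₁ q₂ : List α) :
    appendAt i 0 (rows q₁ q₂) = rows (q₁ ++ [i]) q₂ := by
  cases q₁ <;> cases q₂ <;> simp [rows, appendAt]

theorem appendAt_one_rows {α : Type*} (i : α) {q₁ : List α} (h : q₁ ≠ []) (q₂ : List α) :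
    appendAt i 1 (rows q₁ q₂) = rows q₁ (q₂ ++ [i]) := by
  cases q₂ with
  | nil =>
    rw [rows_nil_of_ne_nil h, rows_of_ne_nil (by simp)]
    simp [appendAt]
  | cons b s =>
    rw [rows_cons, rows_of_ne_nil (by simp)]
    simp [appendAt]

/-- The relation `TwoRow` describes the algorithm: if the entries `xs` stand at the positions `is`,
then `r₁` and `r₂` are the rows of the insertion tableau, and the word `w` is that of the recording
tableau. -/
theorem TwoRow.foldr_rskStep {σ : Equiv.Perm (Fin n)} {xs r₁ r₂ : List (Fin n)}
    {w : List DyckStep} (h : TwoRow xs r₁ r₂ w) :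
    ∀ is : List (Fin n), is.map σ = xs → is.Nodup →
    ∃ q₁ q₂, is.foldr (fun i s => rskStep σ s i) ([], []) = (rows r₁ r₂, rows q₁ q₂) ∧
      q₁.length = r₁.length ∧ (∀ i ∈ q₁, i ∈ is) ∧
      is.map (fun i => if i ∈ q₁ then DyckStep.U else DyckStep.D) = w := by
  induction h with
  | nil =>
    intro is his _
    obtain rfl := List.map_eq_nil_iff.1 his
    exact ⟨[], [], rfl, rfl, by simp, rfl⟩
  | @up x xs r₁ r₂ w h hx ih =>
    intro is his hn
    obtain ⟨i, is, rfl, rfl, his'⟩ := List.map_eq_cons_iff.1 his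
    rw [List.nodup_cons] at hn
    obtain ⟨q₁, q₂, h1, h2, h3, h4⟩ := ih is his' hn.2
    refine ⟨q₁ ++ [i], q₂, ?_, by simp [h2], ?_, ?_⟩
    · rw [List.foldr_cons, h1, rskStep, tableauInsert_rows_of_forall_lt hx, appendAt_zero_rows]
    · intro j hj
      rcases List.mem_append.1 hj with hj | hj
      · exact List.mem_cons_of_mem _ (h3 j hj)
      · simp_all
    · rw [← h4, List.map_cons]
      congr 1
      · simp
      · refine List.map_congr_left fun j hj => ?_
        have : j ≠ i := by
          rintro rfl
          exact hn.1 hj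
        simp [this]
  | @down x m xs a b r₂ w h ha hx hm ih =>
    intro is his hn
    obtain ⟨i, is, rfl, rfl, his'⟩ := List.map_eq_cons_iff.1 his
    rw [List.nodup_cons] at hn
    obtain ⟨q₁, q₂, h1, h2, h3, h4⟩ := ih is his' hn.2
    have hq : q₁ ≠ [] := by
      rintro rfl
      simp at h2
    refine ⟨q₁, q₂ ++ [i], ?_, by simpa using h2,
      fun j hj => List.mem_cons_of_mem _ (h3 j hj), ?_⟩
    · rw [List.foldr_cons, h1, rskStep, tableauInsert_rows_of_lt ha hx hm, appendAt_one_rows _ hq]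
    · rw [← h4, List.map_cons, if_neg fun hi => hn.1 (h3 i hi)]

theorem TwoRow.rsk_eq {σ : Equiv.Perm (Fin n)} {r₁ r₂ : List (Fin n)} {w : List DyckStep}
    (h : TwoRow (entries σ) r₁ r₂ w) :
    (rsk σ).1 = rows r₁ r₂ ∧ (∃ q₁ q₂, (rsk σ).2 = rows q₁ q₂) ∧
      tableauWord (rsk σ).2 = w.reverse := by
  obtain ⟨q₁, q₂, h1, -, -, h4⟩ := h.foldr_rskStep (List.finRange n).reverse
    (by rw [entries, List.map_reverse]) (List.nodup_reverse.2 (List.nodup_finRange n))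
  have h5 : rsk σ = (rows r₁ r₂, rows q₁ q₂) := by
    rw [← h1, rsk, List.foldr_reverse]
  refine ⟨by rw [h5], ⟨q₁, q₂, by rw [h5]⟩, ?_⟩
  rw [h5, tableauWord, headD_rows, ← h4, List.map_reverse, List.reverse_reverse]

theorem TwoRow.knuthWord_eq {σ : Equiv.Perm (Fin n)} {r₁ r₂ : List (Fin n)} {w : List DyckStep}
    (h : TwoRow (entries σ) r₁ r₂ w) :
    knuthWord σ = (List.finRange n).map (fun i => if i ∈ r₁ then DyckStep.U else DyckStep.D) ++
      w.map reverseStep := by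
  obtain ⟨h1, -, h2⟩ := h.rsk_eq
  rw [knuthWord, h2, h1, tableauWord, headD_rows, backwards, List.map_reverse,
    List.reverse_reverse]

theorem take_finRange_succ {t : ℕ} (ht : t < n) :
    (List.finRange n).take (t + 1) = (List.finRange n).take t ++ [⟨t, ht⟩] := by
  rw [List.take_add_one, List.getElem?_eq_getElem (by simpa using ht)]
  simp

/-- The entries of the first row that are smaller than `c` are as many as the elements of a longest
increasing subsequence with values smaller than `c`. -/
theorem TwoRow.countP_lt {σ : Equiv.Perm (Fin n)} {xs r₁ r₂ : List (Fin n)} {w : List DyckStep}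
    (h : TwoRow xs r₁ r₂ w) : ∀ t ≤ n, xs = (((List.finRange n).take t).map σ).reverse →
    ∀ c : ℕ, r₁.countP (fun y : Fin n => (y : ℕ) < c) = lisIn σ t c := by
  induction h with
  | nil =>
    intro t ht hxs c
    have h0 : t = 0 := by
      have := congrArg List.length hxs
      simp at this
      omega
    subst h0
    simp [lisIn_zero_left]
  | @up x xs r₁ r₂ w h hx ih =>
    intro t ht hxs c
    obtain ⟨t, rfl⟩ : ∃ s, t = s + 1 := by
      cases t with
      | zero => simp at hxs
      | succ s => exact ⟨s, rfl⟩
    rw [take_finRange_succ ht, List.map_append, List.reverse_append] at hxs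
    simp only [List.map_cons, List.map_nil, List.reverse_cons, List.reverse_nil, List.nil_append,
      List.cons_append, List.cons.injEq] at hxs
    obtain ⟨rfl, hxs⟩ := hxs
    have ih := ih t (by omega) hxs
    have h1 := ih c
    have h2 := ih (σ ⟨t, ht⟩)
    have h3 : r₁.countP (fun y : Fin n => (y : ℕ) < (σ ⟨t, ht⟩ : ℕ)) = r₁.length :=
      List.countP_eq_length.2 fun y hy => by simpa using hx y hy
    have h4 := List.countP_le_length (p := fun y : Fin n => decide ((y : ℕ) < c)) (l := r₁)
    rw [List.countP_append, List.countP_cons]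
    simp only [List.countP_nil, decide_eq_true_eq]
    split_ifs with hc
    · rw [lisIn_succ_of_lt (i := ⟨t, ht⟩) hc]
      have h5 : r₁.countP (fun y : Fin n => (y : ℕ) < c) = r₁.length :=
        List.countP_eq_length.2 fun y hy => by
          have := Fin.lt_def.1 (hx y hy)
          simp only [decide_eq_true_eq]
          omega
      simp only at *
      omega
    · rw [lisIn_succ_of_le (i := ⟨t, ht⟩) (not_lt.1 hc)]
      simpa using h1
  | @down x m xs a b r₂ w h ha hx hm ih =>
    intro t ht hxs c
    have hs := h.sorted.1
    simp only [List.pairwise_append, List.pairwise_cons] at hs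
    obtain ⟨t, rfl⟩ : ∃ s, t = s + 1 := by
      cases t with
      | zero => simp at hxs
      | succ s => exact ⟨s, rfl⟩
    rw [take_finRange_succ ht, List.map_append, List.reverse_append] at hxs
    simp only [List.map_cons, List.map_nil, List.reverse_cons, List.reverse_nil, List.nil_append,
      List.cons_append, List.cons.injEq] at hxs
    obtain ⟨rfl, hxs⟩ := hxs
    have ih := ih t (by omega) hxs
    have h1 := ih c
    have h2 := ih (σ ⟨t, ht⟩)
    have hx' := Fin.lt_def.1 hx
    have h3 : a.countP (fun y : Fin n => (y : ℕ) < (σ ⟨t, ht⟩ : ℕ)) = a.length :=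
      List.countP_eq_length.2 fun y hy => by simpa using ha y hy
    have h4 : b.countP (fun y : Fin n => (y : ℕ) < (σ ⟨t, ht⟩ : ℕ)) = 0 :=
      List.countP_eq_zero.2 fun y hy => by simpa using (hx.trans (hs.2.1.1 y hy)).le
    rw [List.countP_append, List.countP_cons] at h1 h2 ⊢
    simp only [decide_eq_true_eq] at h1 h2 ⊢
    rw [if_neg (by omega), h3, h4] at h2
    by_cases hc : (σ ⟨t, ht⟩ : ℕ) < c
    · rw [lisIn_succ_of_lt (i := ⟨t, ht⟩) hc, if_pos hc]
      have h5 : a.countP (fun y : Fin n => (y : ℕ) < c) = a.length :=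
        List.countP_eq_length.2 fun y hy => by
          have := Fin.lt_def.1 (ha y hy)
          simp only [decide_eq_true_eq]
          omega
      by_cases hmc : (m : ℕ) < c
      · rw [if_pos hmc] at h1
        simp only at *
        omega
      · rw [if_neg hmc] at h1
        have h6 : b.countP (fun y : Fin n => (y : ℕ) < c) = 0 :=
          List.countP_eq_zero.2 fun y hy => by
            have := Fin.lt_def.1 (hs.2.1.1 y hy)
            simp only [decide_eq_true_eq]
            omega
        simp only at *
        omega
    · rw [lisIn_succ_of_le (i := ⟨t, ht⟩) (not_lt.1 hc), if_neg hc]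
      rw [if_neg (by omega)] at h1
      exact h1

theorem mem_take_finRange {b : ℕ} {i : Fin n} : i ∈ (List.finRange n).take b ↔ (i : ℕ) < b := by
  rw [List.mem_take_iff_getElem]
  constructor
  · rintro ⟨j, hj, rfl⟩
    simp at hj ⊢
    omega
  · intro h
    exact ⟨i, by simp [h], by simp⟩

theorem countP_take_finRange {r : List (Fin n)} (hr : r.Nodup) (b : ℕ) :
    ((List.finRange n).take b).countP (· ∈ r) = r.countP (fun y : Fin n => (y : ℕ) < b) := by
  rw [List.countP_eq_length_filter, List.countP_eq_length_filter]
  refine List.Perm.length_eq ((List.perm_ext_iff_of_nodup ?_ (hr.filter _)).2 fun i => ?_)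
  · exact ((List.nodup_finRange n).sublist (List.take_sublist _ _)).filter _
  · simp only [List.mem_filter, mem_take_finRange, decide_eq_true_eq]
    exact and_comm

/-- The height of the end point of a path that starts at height `0`. -/
def wordHeight (w : List DyckStep) : ℤ := (w.count DyckStep.U : ℤ) - w.count DyckStep.D

theorem count_U_add_count_D (w : List DyckStep) :
    w.count DyckStep.U + w.count DyckStep.D = w.length := by
  induction w with
  | nil => rfl
  | cons s w ih => cases s <;> simp <;> omega

theorem wordHeight_eq (w : List DyckStep) :
    wordHeight w = 2 * w.count DyckStep.U - w.length := by
  have := count_U_add_count_D w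
  rw [wordHeight]
  omega

theorem wordHeight_append (w w' : List DyckStep) :
    wordHeight (w ++ w') = wordHeight w + wordHeight w' := by
  simp only [wordHeight, List.count_append]
  push_cast
  ring

theorem count_map_reverseStep (w : List DyckStep) :
    (w.map reverseStep).count DyckStep.U = w.count DyckStep.D ∧
      (w.map reverseStep).count DyckStep.D = w.count DyckStep.U := by
  induction w with
  | nil => simp
  | cons s w ih => cases s <;> simp [reverseStep, ih]

theorem map_reverseStep_map_reverseStep (w : List DyckStep) :
    (w.map reverseStep).map reverseStep = w := by
  rw [List.map_map]
  conv_rhs => rw [← List.map_id w]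
  refine List.map_congr_left fun s _ => ?_
  cases s <;> rfl

theorem wordHeight_map_reverseStep (w : List DyckStep) :
    wordHeight (w.map reverseStep) = - wordHeight w := by
  rw [wordHeight, wordHeight, (count_map_reverseStep w).1, (count_map_reverseStep w).2]
  ring

theorem TwoRow.nodup_left {σ : Equiv.Perm (Fin n)} {r₁ r₂ : List (Fin n)} {w : List DyckStep}
    (h : TwoRow (entries σ) r₁ r₂ w) : r₁.Nodup :=
  h.sorted.1.imp ne_of_lt

/-- The heights of the word of the insertion tableau. -/
theorem TwoRow.wordHeight_take_left {σ : Equiv.Perm (Fin n)} {r₁ r₂ : List (Fin n)}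
    {w : List DyckStep} (h : TwoRow (entries σ) r₁ r₂ w) {v : ℕ} (hv : v ≤ n) :
    wordHeight (((List.finRange n).map
      (fun i => if i ∈ r₁ then DyckStep.U else DyckStep.D)).take v) = rowHeight σ⁻¹ v := by
  rw [wordHeight_eq, ← List.map_take, rowHeight_inv, List.length_map, List.length_take,
    List.length_finRange, min_eq_left hv, List.count_eq_countP, List.countP_map,
    ← h.countP_lt n le_rfl (by rw [List.take_of_length_le (by simp), entries]) v,
    ← countP_take_finRange h.nodup_left]
  congr 3
  refine List.countP_congr fun i _ => ?_
  by_cases hi : i ∈ r₁ <;> simp [hi]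

/-- Dropping the letters of the last insertions leaves the word of the first ones. -/
theorem TwoRow.wordHeight_drop {σ : Equiv.Perm (Fin n)} {r₁ r₂ : List (Fin n)}
    {w : List DyckStep} (h : TwoRow (entries σ) r₁ r₂ w) {t : ℕ} (ht : t ≤ n) :
    wordHeight (w.drop (n - t)) = rowHeight σ t := by
  obtain ⟨s₁, s₂, hs⟩ := h.drop (n - t)
  have h1 := hs.countP_lt t ht (by
    rw [entries, List.drop_reverse, List.length_map, List.length_finRange, List.map_take,
      Nat.sub_sub_self ht]) n
  rw [List.countP_eq_length.2 fun y _ => by simp, hs.length_left] at h1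
  rw [wordHeight_eq, h1, hs.length_word, rowHeight, List.length_drop, length_entries,
    Nat.sub_sub_self ht]

theorem TwoRow.wordHeight_knuthWord_left {σ : Equiv.Perm (Fin n)} {r₁ r₂ : List (Fin n)}
    {w : List DyckStep} (h : TwoRow (entries σ) r₁ r₂ w) {v : ℕ} (hv : v ≤ n) :
    wordHeight ((knuthWord σ).take v) = rowHeight σ⁻¹ v := by
  rw [h.knuthWord_eq, List.take_append_of_le_length (by simpa using hv), h.wordHeight_take_left hv]

theorem TwoRow.wordHeight_knuthWord_right {σ : Equiv.Perm (Fin n)} {r₁ r₂ : List (Fin n)}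
    {w : List DyckStep} (h : TwoRow (entries σ) r₁ r₂ w) {t : ℕ} (ht : t ≤ n) :
    wordHeight ((knuthWord σ).take (2 * n - t)) = rowHeight σ t := by
  have hlen : ((List.finRange n).map
      (fun i => if i ∈ r₁ then DyckStep.U else DyckStep.D)).length = n := by simp
  have h1 := h.wordHeight_take_left le_rfl
  rw [List.take_of_length_le hlen.le] at h1
  have h2 := h.wordHeight_drop le_rfl
  rw [Nat.sub_self, List.drop_zero] at h2
  have h3 := wordHeight_append (w.take (n - t)) (w.drop (n - t))
  rw [List.take_append_drop, h2, h.wordHeight_drop ht] at h3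
  rw [h.knuthWord_eq, List.take_append, List.take_of_length_le (by omega), hlen,
    show 2 * n - t - n = n - t by omega, wordHeight_append, h1, ← List.map_take,
    wordHeight_map_reverseStep, rowHeight_inv_self]
  omega

end Words

/-! ### The bijection -/

section Bijection

variable {n : ℕ}

theorem exists_twoRow {σ : Equiv.Perm (Fin n)} (h : σ ∈ avoiding n pattern321) :
    ∃ r₁ r₂ w, TwoRow (entries σ) r₁ r₂ w :=
  TwoRow.of_avoids (nodup_entries σ) (mem_avoiding_iff_avoids321.1 h)

theorem length_knuthWord (σ : Equiv.Perm (Fin n)) : (knuthWord σ).length = 2 * n := by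
  simp [knuthWord, tableauWord, backwards, two_mul]

theorem wordHeight_nonneg {σ : Equiv.Perm (Fin n)} (h : σ ∈ avoiding n pattern321) (k : ℕ) :
    0 ≤ wordHeight ((knuthWord σ).take k) := by
  obtain ⟨r₁, r₂, w, hT⟩ := exists_twoRow h
  rcases le_total k n with hk | hk
  · rw [hT.wordHeight_knuthWord_left hk]
    exact (isHeight_rowHeight (inv_mem_avoiding h)).nonneg k hk
  · have h1 : (knuthWord σ).take k = (knuthWord σ).take (2 * n - (2 * n - k)) := by
      rcases le_total k (2 * n) with h2 | h2
      · rw [Nat.sub_sub_self h2]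
      · rw [List.take_of_length_le (by rw [length_knuthWord]; omega),
          List.take_of_length_le (by rw [length_knuthWord]; omega)]
    rw [h1, hT.wordHeight_knuthWord_right (by omega)]
    exact (isHeight_rowHeight h).nonneg _ (by omega)

theorem wordHeight_knuthWord {σ : Equiv.Perm (Fin n)} (h : σ ∈ avoiding n pattern321) :
    wordHeight (knuthWord σ) = 0 := by
  obtain ⟨r₁, r₂, w, hT⟩ := exists_twoRow h
  have h1 := hT.wordHeight_knuthWord_right (Nat.zero_le n)
  rw [List.take_of_length_le (by rw [length_knuthWord]; omega)] at h1
  rw [h1, (isHeight_rowHeight h).zero]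

/-- The path assigned to a `321`-avoiding permutation. -/
def knuthPath (σ : Equiv.Perm (Fin n)) (h : σ ∈ avoiding n pattern321) : DyckWord where
  toList := knuthWord σ
  count_U_eq_count_D := by
    have := wordHeight_knuthWord h
    rw [wordHeight] at this
    omega
  count_D_le_count_U k := by
    have := wordHeight_nonneg h k
    rw [wordHeight] at this
    omega

theorem length_eq_two_mul_semilength (D : DyckWord) : D.toList.length = 2 * D.semilength := by
  have h1 := count_U_add_count_D D.toList
  have h2 := D.count_U_eq_count_D
  rw [DyckWord.semilength]
  omega

theorem semilength_knuthPath {σ : Equiv.Perm (Fin n)} (h : σ ∈ avoiding n pattern321) :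
    (knuthPath σ h).semilength = n := by
  have h1 := length_eq_two_mul_semilength (knuthPath σ h)
  have h2 : (knuthPath σ h).toList.length = 2 * n := length_knuthWord σ
  omega

theorem TwoRow.eq_of_left_eq {σ τ : Equiv.Perm (Fin n)} {r₁ r₂ s₁ s₂ : List (Fin n)}
    {w w' : List DyckStep} (h : TwoRow (entries σ) r₁ r₂ w) (h' : TwoRow (entries τ) s₁ s₂ w')
    (hm : ∀ i, i ∈ r₁ ↔ i ∈ s₁) : r₁ = s₁ ∧ r₂ = s₂ := by
  have hd := h.perm.nodup_iff.2 (nodup_entries σ)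
  have hd' := h'.perm.nodup_iff.2 (nodup_entries τ)
  rw [List.nodup_append] at hd hd'
  have hm₂ : ∀ i, i ∈ r₂ ↔ i ∈ s₂ := by
    intro i
    have h1 := h.mem_iff.1 (mem_entries σ i)
    have h2 := h'.mem_iff.1 (mem_entries τ i)
    have h3 := fun a b => hd.2.2 i a i b rfl
    have h4 := fun a b => hd'.2.2 i a i b rfl
    have h5 := hm i
    tauto
  exact ⟨((List.perm_ext_iff_of_nodup hd.1 hd'.1).2 hm).eq_of_pairwise
      (fun a b _ _ h1 h2 => absurd h1 h2.not_gt) h.sorted.1 h'.sorted.1,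
    ((List.perm_ext_iff_of_nodup hd.2.1 hd'.2.1).2 hm₂).eq_of_pairwise
      (fun a b _ _ h1 h2 => absurd h1 h2.not_gt) h.sorted.2 h'.sorted.2⟩

theorem knuthWord_injective {σ τ : Equiv.Perm (Fin n)} (hσ : σ ∈ avoiding n pattern321)
    (hτ : τ ∈ avoiding n pattern321) (h : knuthWord σ = knuthWord τ) : σ = τ := by
  obtain ⟨r₁, r₂, w, hT⟩ := exists_twoRow hσ
  obtain ⟨s₁, s₂, w', hT'⟩ := exists_twoRow hτ
  rw [hT.knuthWord_eq, hT'.knuthWord_eq] at h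
  obtain ⟨h1, h2⟩ := List.append_inj h (by simp)
  have hw : w = w' := by
    rw [← map_reverseStep_map_reverseStep w, h2, map_reverseStep_map_reverseStep]
  have hm : ∀ i, i ∈ r₁ ↔ i ∈ s₁ := by
    intro i
    have := List.map_inj_left.1 h1 i (List.mem_finRange i)
    by_cases hi : i ∈ r₁ <;> by_cases hi' : i ∈ s₁ <;> simp_all
  obtain ⟨rfl, rfl⟩ := hT.eq_of_left_eq hT' hm
  subst hw
  exact entries_injective (hT.unique hT')

theorem exists_entries_eq {xs : List (Fin n)} (hl : xs.length = n) (hn : xs.Nodup) :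
    ∃ σ : Equiv.Perm (Fin n), entries σ = xs := by
  have hl' : xs.reverse.length = n := by simpa using hl
  have hinj : Function.Injective fun i : Fin n => xs.reverse.get (i.cast hl'.symm) := by
    intro i j hij
    have := (List.nodup_reverse.2 hn).injective_get hij
    simpa using this
  refine ⟨Equiv.ofBijective _ (Finite.injective_iff_bijective.1 hinj), ?_⟩
  rw [entries, List.reverse_eq_iff]
  refine List.ext_getElem (by simp [hl]) fun i h1 h2 => ?_
  simp

/-- The left half of a Dyck path gives the two rows of the insertion tableau, the right half, with
its steps interchanged, gives the recording word, from the last letter to the first. -/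
theorem exists_knuthWord_eq {D : DyckWord} (hD : D.semilength = n) :
    ∃ σ ∈ avoiding n pattern321, knuthWord σ = D.toList := by
  have hlen : D.toList.length = 2 * n := by rw [length_eq_two_mul_semilength, hD]
  set g : Fin n → DyckStep := fun i => D.toList[(i : ℕ)]'(by have := i.2; omega)
  have htake : ∀ k ≤ n, D.toList.take k = ((List.finRange n).take k).map g := by
    intro k hk
    refine List.ext_getElem (by simp [hlen]; omega) fun i h1 h2 => ?_
    simp [g]
  set r₁ := (List.finRange n).filter fun i => g i = DyckStep.U
  set r₂ := (List.finRange n).filter fun i => g i = DyckStep.D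
  have hn₁ : r₁.Nodup := (List.nodup_finRange n).filter _
  have hn₂ : r₂.Nodup := (List.nodup_finRange n).filter _
  have hcU : ∀ k ≤ n,
      (D.toList.take k).count DyckStep.U = r₁.countP fun y : Fin n => (y : ℕ) < k := by
    intro k hk
    rw [htake k hk, ← countP_take_finRange hn₁, List.count_eq_countP, List.countP_map]
    refine List.countP_congr fun i _ => ?_
    simp [r₁]
  have hcD : ∀ k ≤ n,
      (D.toList.take k).count DyckStep.D = r₂.countP fun y : Fin n => (y : ℕ) < k := by
    intro k hk
    rw [htake k hk, ← countP_take_finRange hn₂, List.count_eq_countP, List.countP_map]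
    refine List.countP_congr fun i _ => ?_
    simp [r₂]
  have hU := hcU n le_rfl
  have hDn := hcD n le_rfl
  rw [List.countP_eq_length.2 fun y _ => by simp] at hU
  rw [List.countP_eq_length.2 fun y _ => by simp] at hDn
  have htot : ∀ k (s : DyckStep),
      (D.toList.take k).count s + (D.toList.drop k).count s = D.toList.count s := by
    intro k s
    rw [← List.count_append, List.take_append_drop]
  have hUtot : D.toList.count DyckStep.U = n := hD
  have hDtot : D.toList.count DyckStep.D = n := by rw [← D.count_U_eq_count_D, hUtot]
  have hsum := count_U_add_count_D (D.toList.take n)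
  rw [List.length_take, hlen] at hsum
  have htU := htot n DyckStep.U
  have htD := htot n DyckStep.D
  obtain ⟨xs, hT⟩ := TwoRow.exists_of_ballot (r₁ := r₁) (r₂ := r₂)
    (w := (D.toList.drop n).map reverseStep)
    ((List.pairwise_lt_finRange n).filter _) ((List.pairwise_lt_finRange n).filter _)
    (by simp [r₁, r₂]; intro y hy; simp [hy])
    (by
      intro v
      have h1 := D.count_D_le_count_U (v + 1)
      rw [hcU _ v.2, hcD _ v.2] at h1
      simpa [Nat.lt_succ_iff] using h1)
    (by rw [(count_map_reverseStep _).1]; omega)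
    (by rw [(count_map_reverseStep _).2]; omega)
    (by
      intro k
      rw [← List.map_drop, (count_map_reverseStep _).1, (count_map_reverseStep _).2,
        List.drop_drop]
      have h1 := D.count_D_le_count_U (n + k)
      have h2 := htot (n + k) DyckStep.U
      have h3 := htot (n + k) DyckStep.D
      omega)
  have hxn : xs.Nodup := by
    rw [← hT.perm.nodup_iff, List.nodup_append]
    refine ⟨hn₁, hn₂, fun a ha b hb => ?_⟩
    simp only [r₁, r₂, List.mem_filter, List.mem_finRange, true_and, decide_eq_true_eq] at ha hb
    rintro rfl
    simp [ha] at hb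
  have hxl : xs.length = n := by
    rw [← hT.length_word, List.length_map, List.length_drop]
    omega
  obtain ⟨σ, rfl⟩ := exists_entries_eq hxl hxn
  refine ⟨σ, mem_avoiding_iff_avoids321.2 hT.avoids, ?_⟩
  rw [hT.knuthWord_eq, map_reverseStep_map_reverseStep]
  conv_rhs => rw [← List.take_append_drop n D.toList, htake n le_rfl]
  rw [List.take_of_length_le (by simp)]
  congr 1
  refine List.map_congr_left fun i _ => ?_
  by_cases hi : g i = DyckStep.U
  · simp [r₁, hi]
  · rw [(DyckStep.dichotomy (g i)).resolve_left hi]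
    simp [r₁, hi]

theorem statistics_knuthPath {σ : Equiv.Perm (Fin n)} (h : σ ∈ avoiding n pattern321) :
    fp σ = ct (knuthPath σ h) ∧ exc σ = rt (knuthPath σ h) ∧
      (lis σ : ℚ) = ((n : ℚ) + (midHeight (knuthPath σ h) : ℚ)) / 2 := by
  obtain ⟨r₁, r₂, w, hT⟩ := exists_twoRow h
  have hs := semilength_knuthPath h
  have hD : (knuthPath σ h).toList.length = 2 * n := length_knuthWord σ
  have hf : ∀ v ≤ n, height (knuthPath σ h) v = rowHeight σ⁻¹ v :=
    fun v hv => hT.wordHeight_knuthWord_left hv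
  have hg : ∀ t ≤ n, height (knuthPath σ h) (2 * n - t) = rowHeight σ t :=
    fun t ht => hT.wordHeight_knuthWord_right ht
  have hF := isHeight_rowHeight (inv_mem_avoiding h)
  have hG := isHeight_rowHeight h
  obtain ⟨m, hm⟩ := Int.eq_ofNat_of_zero_le (hG.nonneg n le_rfl)
  obtain ⟨q, hq, hq'⟩ := hG.exists_last hm
  obtain ⟨p, hp, hp'⟩ := hF.exists_last ((rowHeight_inv_self σ).trans hm)
  obtain ⟨h1, h2⟩ := fp_and_exc_eq h hm hp hp' hq hq'
  refine ⟨?_, ?_, ?_⟩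
  · rw [h1, ct_eq hD hf hg hp hp' hq hq' hs]
  · rw [h2, rt_eq hD hG hf hg hp hp' hq hq' hs]
  · rw [midHeight, hs, hf n le_rfl, rowHeight_inv, lis_eq_lisIn]
    push_cast
    ring

end Bijection

end KnuthDyck

theorem proposition1 (n : ℕ) :
    (∀ σ ∈ avoiding n pattern321, (rsk σ).1.length ≤ 2 ∧ (rsk σ).2.length ≤ 2) ∧
    ∃ Ψ : avoiding n pattern321 ≃ {p : DyckWord // p.semilength = n},
      ∀ σ : avoiding n pattern321,
        (Ψ σ).1.toList = knuthWord σ.1 ∧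
        fp σ.1 = ct (Ψ σ).1 ∧
        exc σ.1 = rt (Ψ σ).1 ∧
        (lis σ.1 : ℚ) = ((n : ℚ) + (midHeight (Ψ σ).1 : ℚ)) / 2 := by
  refine ⟨fun σ h => ?_, Equiv.ofBijective
    (fun σ => ⟨knuthPath σ.1 σ.2, semilength_knuthPath σ.2⟩) ⟨?_, ?_⟩, fun σ => ?_⟩
  · obtain ⟨r₁, r₂, w, hT⟩ := exists_twoRow h
    obtain ⟨h1, ⟨q₁, q₂, h2⟩, -⟩ := hT.rsk_eq
    rw [h1, h2]
    exact ⟨length_rows_le _ _, length_rows_le _ _⟩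
  · rintro ⟨σ, hσ⟩ ⟨τ, hτ⟩ he
    have h1 : knuthWord σ = knuthWord τ :=
      congrArg (fun D : {p : DyckWord // p.semilength = n} => D.1.toList) he
    exact Subtype.ext (knuthWord_injective hσ hτ h1)
  · rintro ⟨D, hD⟩
    obtain ⟨σ, hσ, he⟩ := exists_knuthWord_eq hD
    exact ⟨⟨σ, hσ⟩, Subtype.ext (DyckWord.ext he)⟩
  · exact ⟨rfl, statistics_knuthPath σ.2⟩
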